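/- **Conventions.** A matrix $\Phi\in\mathbb{C}^{d\times n}$ is an *equiangular tight frame* (a $d\times n$ ETF) if its columns have unit norm, $\Phi\Phi^*$ is a multiple of the identity, and the off-diagonal entries of $\Phi^*\Phi$ have constant modulus $\gamma$. When $n>d$ we have $\gamma>0$ and write $\Phi^*\Phi=I+\gamma S$; $S$ is the *signature matrix* of $\Phi$. Two ETFs in $\mathbb{C}^d$ are *switching equivalent* if one is obtained from the other by applying a unitary on the left, multiplying the columns by unimodular scalars, and reindexing the columns. A $d\times 2d$ ETF is *$2$-circulant* if it has the form $[X\mid Y]$ with $X,Y\in\mathbb{C}^{d\times d}$ circulant. For the signature matrix $S$ of a $d\times n$ ETF with $n-2d\in\{-1,0,1\}$ and for $\varepsilon\in\{\pm1\}$, put $c=(n-2d)\sqrt{\tfrac{n-1}{d(n-d)}}$, $\beta=-c+\varepsilon\mathrm{i}\sqrt{1-c^2}$ and $$\mathcal{D}_{d,\varepsilon}(S)=\begin{bmatrix} S & S+\beta I\\ S+\overline{\beta} I & -S\end{bmatrix}.$$ Let $q$ be an odd prime power. Let $A\in\{0,1\}^{\mathbb{F}_q\times\mathbb{F}_q}$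 have $A_{ab}=1$ if and only if $a-b$ is a nonzero square, let $B=J-I-A$ ($J$ is the all-ones matrix) and $T=A-B$. Let $$C=\begin{bmatrix}0&\mathbf 1^\top\\ \pm\mathbf 1&T\end{bmatrix},$$ with sign $+$ if $q\equiv1\bmod 4$ and $-$ if $q\equiv3\bmod4$, and let $\omega=1$ if $q\equiv 1\bmod 4$ and $\omega=\mathrm{i}$ if $q\equiv3\bmod4$. **Theorem.** Each of the following matrices $S$ is the signature matrix of a $d\times 2d$ ETF with the indicated $d$, and every $d\times 2d$ ETF with signature matrix $S$ is switching equivalent to a $2$-circulant $d\times 2d$ ETF. 1. (Paley ETFs $G_q+1$; $q$ any odd prime power.) $S=\pm\omega C$, with $d=\frac{q+1}{2}$. 2. (Doubled Paley ETFs $2\cdot G_q$; $q$ an odd prime.) Here $d=q$. - If $q\equiv1\bmod4$: for either $\varepsilon\in\{\pm1\}$, $$S=\begin{bmatrix}A-B&\varepsilon I+\beta A+\overline\beta B\\ \varepsilon I+\overline\beta A+\beta B&B-A\end{bmatrix},$$ where $\beta=\varepsilon x+\mathrm{i}\sqrt{1-x^2}$ and $x=\frac{-1+\sqrt{2q-1}}{q-1}$.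 - If $q\equiv3\bmod4$: $S=\mathcal{D}_{(q+1)/2,\varepsilon}(R)$ or $S=\mathcal{D}_{(q-1)/2,\varepsilon}(-R)$, for either $\varepsilon\in\{\pm1\}$, where $R$ is the signature matrix of the $\frac{q+1}{2}\times q$ Renes–Strohmer ETF, whose Gram matrix $I+\frac{1}{\sqrt{q+1}}R$ is the multiple with unit diagonal of $\mathrm{i}T+\frac1{\sqrt q}J+\sqrt q\,I$ (and $-R$ is the signature matrix of its $\frac{q-1}{2}\times q$ Naimark complement). 3. (Doubled ETFs $2\cdot(G_q+1)$; $q$ any odd prime power.) $S=\mathcal{D}_{(q+1)/2,\varepsilon}(\pm\omega C)$ for either choice of signs, with $d=q+1$. -/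

import Mathlib

open scoped Matrix

/-! ## Equiangular tight frames -/

/-- A `d × n` equiangular tight frame: unit-norm columns, frame operator `Φ Φ*` a multiple of the
identity, and off-diagonal entries of the Gram matrix `Φ* Φ` of constant modulus. -/
structure IsETF {d : ℕ} {ι : Type*} [Fintype ι] (Φ : Matrix (Fin d) ι ℂ) : Prop where
  unit_norm : ∀ j, ∑ i, ‖Φ i j‖ ^ 2 = 1
  tight : ∃ a : ℂ, Φ * Φᴴ = a • (1 : Matrix (Fin d) (Fin d) ℂ)
  equiangular : ∃ γ : ℝ, ∀ j k, j ≠ k → ‖(Φᴴ * Φ) j k‖ = γ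

/-- `S` is the signature matrix of `Φ`: it has zero diagonal and unimodular off-diagonal entries,
and the Gram matrix is `Φ* Φ = I + γ S` with `γ > 0` (the common modulus of the off-diagonal
entries of the Gram matrix). -/
structure HasSignature {d : ℕ} {ι : Type*} [Fintype ι] [DecidableEq ι]
    (Φ : Matrix (Fin d) ι ℂ) (S : Matrix ι ι ℂ) : Prop where
  diag_zero : ∀ j, S j j = 0
  off_diag_unimodular : ∀ j k, j ≠ k → ‖S j k‖ = 1
  gram : ∃ γ : ℝ, 0 < γ ∧ Φᴴ * Φ = 1 + (γ : ℂ) • S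

/-- Switching equivalence of two finite sequences of vectors in `ℂ^d` (the columns of `Φ`, `Ψ`):
one arises from the other by a unitary on the left, phasing the vectors and reindexing. -/
def SwitchingEquivalent {d : ℕ} {ι κ : Type*} (Φ : Matrix (Fin d) ι ℂ)
    (Ψ : Matrix (Fin d) κ ℂ) : Prop :=
  ∃ U ∈ Matrix.unitaryGroup (Fin d) ℂ, ∃ e : ι ≃ κ, ∃ c : ι → ℂ, (∀ j, ‖c j‖ = 1) ∧
    ∀ i j, Φ i j = c j * (U * Ψ) i (e j)

/-- A `d × td` matrix, consisting of `t` blocks of size `d × d`, is `t`-circulant if each block is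
circulant (subtraction in `Fin d` is modulo `d`). -/
def IsTCirculant {d t : ℕ} (Ψ : Matrix (Fin d) (Fin t × Fin d) ℂ) : Prop :=
  ∀ k : Fin t, ∃ v : Fin d → ℂ, Ψ.submatrix id (fun j => (k, j)) = Matrix.circulant v

/-- `S` is the signature matrix of some ETF in `ℂ^d`, and every ETF in `ℂ^d` with signature
matrix `S` is switching equivalent to a `2`-circulant `d × 2d` ETF. -/
def SwitchesToTwoCirculantETF {ι : Type*} [Fintype ι] [DecidableEq ι] (d : ℕ)
    (S : Matrix ι ι ℂ) : Prop :=
  (∃ Φ : Matrix (Fin d) ι ℂ, IsETF Φ ∧ HasSignature Φ S) ∧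
  ∀ Φ : Matrix (Fin d) ι ℂ, IsETF Φ → HasSignature Φ S →
    ∃ Ψ : Matrix (Fin d) (Fin 2 × Fin d) ℂ,
      IsETF Ψ ∧ IsTCirculant Ψ ∧ SwitchingEquivalent Φ Ψ

/-! ## Doubling of ETF signature matrices -/

/-- `c = (n - 2d) √((n - 1) / (d (n - d)))`. -/
noncomputable def doublingConst (d n : ℕ) : ℝ :=
  ((n : ℝ) - 2 * d) * √(((n : ℝ) - 1) / (d * ((n : ℝ) - d)))

/-- `β = -c + ε i √(1 - c²)`. -/
noncomputable def doublingBeta (d n : ℕ) (ε : ℤˣ) : ℂ :=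
  -(doublingConst d n : ℂ) + ((ε : ℤ) : ℂ) * Complex.I * (√(1 - doublingConst d n ^ 2) : ℝ)

/-- The double `[S, S + βI; S + β̄I, -S]` of the signature matrix `S` of a `d × n` ETF, where `n` is
the size of `S`. -/
noncomputable def doubleSignature {ι : Type*} [Fintype ι] [DecidableEq ι] (d : ℕ) (ε : ℤˣ)
    (S : Matrix ι ι ℂ) : Matrix (ι ⊕ ι) (ι ⊕ ι) ℂ :=
  Matrix.fromBlocks
    S (S + doublingBeta d (Fintype.card ι) ε • (1 : Matrix ι ι ℂ))
    (S + star (doublingBeta d (Fintype.card ι) ε) • (1 : Matrix ι ι ℂ)) (-S)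

/-! ## The Paley constructions -/

/-- Adjacency (`a → b`) in the Paley graph (for `q ≡ 1 mod 4`) or the Paley digraph
(for `q ≡ 3 mod 4`): the difference `a - b` is a nonzero square. -/
def PaleyAdj {F : Type*} [Field F] (a b : F) : Prop :=
  a - b ≠ 0 ∧ IsSquare (a - b)

/-- The `{0,1}`-adjacency matrix `A` of the Paley graph. -/
noncomputable def paleyAdjMatrix (F : Type*) [Field F] : Matrix F F ℂ :=
  open Classical in
  Matrix.of fun a b => if PaleyAdj a b then 1 else 0

/-- The Seidel adjacency matrix of the Paley (di)graph: zero diagonal, and off the diagonal `1`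
where `a → b` and `-1` elsewhere. -/
noncomputable def paleySeidel (F : Type*) [Field F] : Matrix F F ℂ :=
  open Classical in
  Matrix.of fun a b => if a = b then 0 else if PaleyAdj a b then 1 else -1

/-- The Paley conference matrix of order `q + 1`: `[0, 1; 1, S]` if `q ≡ 1 mod 4` and
`[0, 1; -1, T]` otherwise, bordering the Seidel matrix by all-ones vectors. -/
noncomputable def paleyConference (F : Type*) [Field F] [Fintype F] :
    Matrix (Unit ⊕ F) (Unit ⊕ F) ℂ :=
  Matrix.fromBlocks
    0 (Matrix.of fun _ _ => 1)
    (Matrix.of fun _ _ => if Fintype.card F % 4 = 1 then 1 else -1) (paleySeidel F)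

/-- The signature matrix of the Paley ETF: `C` for the symmetric, `iC` for the
skew-symmetric Paley conference matrix `C`. The other Paley ETF comes from `-C`. -/
noncomputable def paleySignature (F : Type*) [Field F] [Fintype F] (δ : ℤˣ) :
    Matrix (Unit ⊕ F) (Unit ⊕ F) ℂ :=
  (((δ : ℤ) : ℂ) * (if Fintype.card F % 4 = 1 then 1 else Complex.I)) • paleyConference F

/-- `x = (-1 + √(2v - 1)) / (v - 1)`. -/
noncomputable def graphDoublingX (v : ℕ) : ℝ := (-1 + √(2 * (v : ℝ) - 1)) / ((v : ℝ) - 1)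

/-- `β = εx + iy` with `y = √(1 - x²)`. -/
noncomputable def graphDoublingBeta (v : ℕ) (ε : ℤˣ) : ℂ :=
  ((ε : ℤ) : ℂ) * (graphDoublingX v : ℂ) + Complex.I * (√(1 - graphDoublingX v ^ 2) : ℝ)

/-- The signature matrix obtained by doubling a conference graph with adjacency matrix `A`,
`B = J - I - A` being the adjacency matrix of the complementary graph:
`[A - B, εI + βA + β̄B; εI + β̄A + βB, B - A]`. -/
noncomputable def doubleGraphSignature {ι : Type*} [Fintype ι] [DecidableEq ι] (ε : ℤˣ)
    (A : Matrix ι ι ℂ) : Matrix (ι ⊕ ι) (ι ⊕ ι) ℂ :=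
  let B : Matrix ι ι ℂ := (Matrix.of fun _ _ => 1) - 1 - A
  let β : ℂ := graphDoublingBeta (Fintype.card ι) ε
  let e : ℂ := ((ε : ℤ) : ℂ)
  Matrix.fromBlocks
    (A - B) (e • (1 : Matrix ι ι ℂ) + β • A + star β • B)
    (e • (1 : Matrix ι ι ℂ) + star β • A + β • B) (B - A)

/-- The Gram matrix of the Renes--Strohmer ETF of the Paley digraph, namely the multiple with unit
diagonal of `iT + (1/√q) J + √q I`, where `T` is the Seidel adjacency matrix. -/
noncomputable def renesStrohmerGram (F : Type*) [Field F] [Fintype F] [DecidableEq F] :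
    Matrix F F ℂ :=
  let r : ℝ := √(Fintype.card F : ℝ)
  ((1 / r + r : ℝ) : ℂ)⁻¹ •
    (Complex.I • paleySeidel F + ((1 / r : ℝ) : ℂ) • (Matrix.of fun _ _ => 1)
      + (r : ℂ) • (1 : Matrix F F ℂ))

/-- The signature matrix of the Renes--Strohmer ETF: the off-diagonal part of the Gram matrix
divided by the common modulus `1/√(q+1)` of its entries. -/
noncomputable def renesStrohmerSignature (F : Type*) [Field F] [Fintype F] [DecidableEq F] :
    Matrix F F ℂ :=
  ((√((Fintype.card F : ℝ) + 1) : ℝ) : ℂ) • (renesStrohmerGram F - 1)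

/-! A tight frame is determined up to a unitary by its Gram matrix, so everything reduces to the
signature matrix. The criterion `switchesToTwoCirculantETF_of_circulant_blocks` says that it
suffices to permute and phase S into [X, Y; Y*, -X] with X, Y circulant. Indeed S² = (2d-1)I gives
X² + YY* = (2d-1)I; after rescaling, the discrete Fourier transform splits I + γS into d Hermitian 2
× 2 matrices [1+f, g; ḡ, 1-f] with f² + |g|² = 1. Each has determinant 0 and trace 2, hence is the
Gram matrix of a single row (a, b). The numbers a and b are the eigenvalues of the two circulant
blocks of the frame.

For the doubles of G_q with q prime, the blocks already depend only on differences in F_q, whose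
additive group is cyclic. Only S² = (2q-1)I has to be checked, from T² = χ(-1)(qI - J) and TJ = JT =
0.

For G_q + 1 and its doubles, q may be a prime power. There the Paley conference matrix is χ(det(x,
y)) on points of the projective line, and a generator of the multiplicative group of F_{q²} runs
through these points cyclically (`exists_singer_cycle`). In this order the matrix becomes (-1)^j
h(i-j) up to switching, where h(m+q+1) = -h(m) (`exists_singer_order`). Separating even from odd
positions absorbs the sign (-1)^j and produces the pattern X, Y, -X. Phases ζ^i, with ζ^d = -1 for
the block size d, turn the resulting negacyclic blocks into circulant ones. -/

/-! ### Frames and their Gram matrices -/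

section Gram

variable {d : ℕ} {ι : Type*} [Fintype ι]

open scoped ComplexOrder in
/-- If the Gram matrix of `Φ` is twice a projection of rank `d`, the frame operator is `2`. -/
lemma mul_conjTranspose_eq_two_of_gram {Φ : Matrix (Fin d) ι ℂ}
    (hG : (Φᴴ * Φ) * (Φᴴ * Φ) = (2 : ℂ) • (Φᴴ * Φ)) (ht : (Φᴴ * Φ).trace = 2 * d) :
    Φ * Φᴴ = (2 : ℂ) • (1 : Matrix (Fin d) (Fin d) ℂ) := by
  set H : Matrix (Fin d) (Fin d) ℂ := Φ * Φᴴ - (2 : ℂ) • 1 with hH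
  have hherm : Hᴴ = H := by
    simp [hH, Matrix.conjTranspose_sub, Matrix.conjTranspose_mul, Matrix.conjTranspose_smul]
  have h1 : (Φ * Φᴴ).trace = 2 * d := by rw [Matrix.trace_mul_comm, ht]
  have h2 : (Φ * Φᴴ * (Φ * Φᴴ)).trace = 4 * d := by
    rw [show Φ * Φᴴ * (Φ * Φᴴ) = Φ * (Φᴴ * Φ * Φᴴ) by simp only [Matrix.mul_assoc],
      Matrix.trace_mul_comm, show Φᴴ * Φ * Φᴴ * Φ = (Φᴴ * Φ) * (Φᴴ * Φ) by
        simp only [Matrix.mul_assoc], hG, Matrix.trace_smul, ht, smul_eq_mul]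
    ring
  -- The squared Frobenius norm of H is 4d - 2·2·2d + 4d = 0.
  have h3 : (Hᴴ * H).trace = 0 := by
    rw [hherm, hH, sub_mul, mul_sub, mul_sub]
    simp only [Matrix.trace_sub, h2, Matrix.mul_smul, Matrix.smul_mul, Matrix.one_mul,
      Matrix.mul_one, Matrix.trace_smul, h1, Matrix.trace_one, Fintype.card_fin, smul_eq_mul]
    ring
  exact sub_eq_zero.1 (Matrix.trace_conjTranspose_mul_self_eq_zero_iff.1 h3)

/-- The unitary is ½ΦΨ*: replacing Ψ*Ψ by Φ*Φ gives UU* = ¼(ΦΦ*)² = I and UΨ = ½ΦΦ*Φ = Φ. -/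
lemma exists_unitary_of_gram_eq {Φ Ψ : Matrix (Fin d) ι ℂ} (h : Φᴴ * Φ = Ψᴴ * Ψ)
    (hΦ : Φ * Φᴴ = (2 : ℂ) • (1 : Matrix (Fin d) (Fin d) ℂ)) :
    ∃ U ∈ Matrix.unitaryGroup (Fin d) ℂ, Φ = U * Ψ := by
  have h2 : star (2⁻¹ : ℂ) = 2⁻¹ := by simp
  refine ⟨(2⁻¹ : ℂ) • (Φ * Ψᴴ), ?_, ?_⟩
  · rw [Matrix.mem_unitaryGroup_iff, Matrix.star_eq_conjTranspose, Matrix.conjTranspose_smul,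
      Matrix.conjTranspose_mul, Matrix.conjTranspose_conjTranspose, h2, Matrix.smul_mul,
      Matrix.mul_smul, show Φ * Ψᴴ * (Ψ * Φᴴ) = Φ * (Ψᴴ * Ψ) * Φᴴ by
        simp only [Matrix.mul_assoc], ← h,
      show Φ * (Φᴴ * Φ) * Φᴴ = (Φ * Φᴴ) * (Φ * Φᴴ) by simp only [Matrix.mul_assoc], hΦ]
    simp only [Matrix.smul_mul, Matrix.one_mul, smul_smul]
    norm_num
  · rw [Matrix.smul_mul, Matrix.mul_assoc, ← h, ← Matrix.mul_assoc, hΦ, Matrix.smul_mul,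
      Matrix.one_mul, smul_smul]
    norm_num

variable [DecidableEq ι]

lemma gram_sq {S G : Matrix ι ι ℂ} {γ : ℂ} (hG : G = 1 + γ • S)
    (hS : (γ ^ 2) • (S * S) = 1) : G * G = (2 : ℂ) • G := by
  rw [hG, add_mul, mul_add, mul_add]
  have h : (γ • S) * (γ • S) = 1 := by
    rw [Matrix.smul_mul, Matrix.mul_smul, smul_smul, ← sq γ, hS]
  rw [h, one_mul, mul_one, one_mul, two_smul]
  abel

/-- Since (γS)² = I, the matrix I + γS is twice a projection, and its trace 2d makes the rank d;
this yields tightness. -/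
lemma isETF_hasSignature_of_gram {S : Matrix ι ι ℂ} (hdiag : ∀ j, S j j = 0)
    (huni : ∀ j k, j ≠ k → ‖S j k‖ = 1) (hcard : Fintype.card ι = 2 * d)
    {γ : ℝ} (hγ : 0 < γ) (hS : ((γ : ℂ) ^ 2) • (S * S) = 1) {Φ : Matrix (Fin d) ι ℂ}
    (hG : Φᴴ * Φ = 1 + (γ : ℂ) • S) : IsETF Φ ∧ HasSignature Φ S := by
  refine ⟨⟨fun j => ?_, ⟨2, mul_conjTranspose_eq_two_of_gram (gram_sq hG hS) ?_⟩,
    ⟨γ, fun j k hjk => ?_⟩⟩, ⟨hdiag, huni, γ, hγ, hG⟩⟩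
  · have := congrFun (congrFun hG j) j
    simp only [Matrix.mul_apply, Matrix.conjTranspose_apply, Matrix.add_apply, Matrix.one_apply_eq,
      Matrix.smul_apply, hdiag, smul_zero, add_zero, RCLike.star_def, Complex.conj_mul'] at this
    exact_mod_cast this
  · rw [hG, Matrix.trace_add, Matrix.trace_one, Matrix.trace_smul, hcard, Matrix.trace]
    simp [hdiag]
  · rw [hG, Matrix.add_apply, Matrix.one_apply_ne hjk, Matrix.smul_apply, zero_add, norm_smul,
      huni j k hjk]
    simp [abs_of_pos hγ]

/-- The frame operator and the Gram matrix of a `d × 2d` ETF with given signature matrix. -/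
lemma HasSignature.tight_gram {S : Matrix ι ι ℂ} (hd : 0 < d) (hcard : Fintype.card ι = 2 * d)
    (hS : S * S = (2 * d - 1 : ℂ) • (1 : Matrix ι ι ℂ)) {Φ : Matrix (Fin d) ι ℂ} (hΦ : IsETF Φ)
    (hΦS : HasSignature Φ S) :
    Φ * Φᴴ = (2 : ℂ) • (1 : Matrix (Fin d) (Fin d) ℂ) ∧
      Φᴴ * Φ = 1 + ((√(2 * d - 1) : ℝ)⁻¹ : ℂ) • S := by
  obtain ⟨a, ha⟩ := hΦ.tight
  obtain ⟨γ, hγ, hG⟩ := hΦS.gram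
  have hdC : (d : ℂ) ≠ 0 := by exact_mod_cast hd.ne'
  have htr : (Φᴴ * Φ).trace = 2 * d := by
    rw [hG, Matrix.trace_add, Matrix.trace_one, Matrix.trace_smul, hcard, Matrix.trace]
    simp [hΦS.diag_zero]
  have ha2 : a = 2 := by
    rw [Matrix.trace_mul_comm, ha, Matrix.trace_smul, Matrix.trace_one, Fintype.card_fin,
      smul_eq_mul] at htr
    exact mul_right_cancel₀ hdC htr
  subst ha2
  refine ⟨ha, ?_⟩
  have hGG : (Φᴴ * Φ) * (Φᴴ * Φ) = (2 : ℂ) • (Φᴴ * Φ) := by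
    rw [show Φᴴ * Φ * (Φᴴ * Φ) = Φᴴ * (Φ * Φᴴ) * Φ by simp only [Matrix.mul_assoc], ha]
    simp
  have hne : Nonempty ι := Fintype.card_pos_iff.1 (by omega)
  obtain ⟨j⟩ := hne
  -- A diagonal entry of G² = 2G reads 1 + γ²(2d-1) = 2, which determines γ.
  have hj := congrFun (congrFun hGG j) j
  rw [hG, add_mul, mul_add, mul_add] at hj
  simp only [one_mul, mul_one, Matrix.smul_mul, Matrix.mul_smul, hS, Matrix.add_apply,
    Matrix.smul_apply, Matrix.one_apply_eq, hΦS.diag_zero, smul_eq_mul] at hj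
  have h1 : γ ^ 2 * (2 * d - 1) = 1 := by
    have : (γ : ℂ) ^ 2 * (2 * d - 1) = 1 := by linear_combination hj
    exact_mod_cast this
  have hd1 : (1 : ℝ) ≤ d := by exact_mod_cast hd
  have h2 : γ = (√(2 * d - 1))⁻¹ := by
    rw [← Real.sqrt_inv, eq_comm, Real.sqrt_eq_iff_mul_self_eq_of_pos hγ, ← sq]
    exact (inv_eq_of_mul_eq_one_left h1).symm
  rw [hG, h2, Complex.ofReal_inv]

end Gram

/-! ### Circulant matrices and the discrete Fourier transform -/

section Circulant

lemma inv_sqrt_mul_inv_sqrt (d : ℕ) : ((√(d : ℝ) : ℝ) : ℂ)⁻¹ * ((√(d : ℝ) : ℝ) : ℂ)⁻¹ = (d : ℂ)⁻¹ := by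
  rw [← mul_inv, ← Complex.ofReal_mul, Real.mul_self_sqrt (Nat.cast_nonneg d)]
  simp

variable {d : ℕ} [NeZero d]

/-- The unitary discrete Fourier transform matrix. -/
noncomputable def dftMatrix (d : ℕ) [NeZero d] : Matrix (ZMod d) (ZMod d) ℂ :=
  Matrix.of fun i k => ((√(d : ℝ) : ℝ) : ℂ)⁻¹ * ZMod.stdAddChar (i * k)

lemma star_stdAddChar (a : ZMod d) : star (ZMod.stdAddChar a) = ZMod.stdAddChar (-a) := by
  rw [AddChar.map_neg_eq_conj]; rfl

lemma dftMatrix_conjTranspose_mul : (dftMatrix d)ᴴ * dftMatrix d = 1 := by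
  ext k l
  have hd : (d : ℂ) ≠ 0 := by exact_mod_cast NeZero.ne d
  have h : ∀ i : ZMod d, star (dftMatrix d i k) * dftMatrix d i l
      = (d : ℂ)⁻¹ * ZMod.stdAddChar (i * (l - k)) := fun i => by
    simp only [dftMatrix, Matrix.of_apply, star_mul', star_stdAddChar]
    rw [show i * (l - k) = -(i * k) + i * l by ring, AddChar.map_add_eq_mul,
      ← inv_sqrt_mul_inv_sqrt]
    simp
    ring
  simp only [Matrix.mul_apply, Matrix.conjTranspose_apply, h, ← Finset.mul_sum,
    AddChar.sum_mulShift _ (ZMod.isPrimitive_stdAddChar d), ZMod.card, sub_eq_zero]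
  by_cases hkl : k = l
  · subst hkl
    simp [hd]
  · simp [hkl, Ne.symm hkl]

lemma dftMatrix_mul_conjTranspose : dftMatrix d * (dftMatrix d)ᴴ = 1 :=
  mul_eq_one_comm.1 dftMatrix_conjTranspose_mul

/-- The circulant matrix with given eigenvalues. -/
noncomputable def spectralCirculant (f : ZMod d → ℂ) : Matrix (ZMod d) (ZMod d) ℂ :=
  dftMatrix d * Matrix.diagonal f * (dftMatrix d)ᴴ

lemma spectralCirculant_mul (f g : ZMod d → ℂ) :
    spectralCirculant f * spectralCirculant g = spectralCirculant (f * g) := by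
  unfold spectralCirculant
  rw [show dftMatrix d * Matrix.diagonal f * (dftMatrix d)ᴴ *
      (dftMatrix d * Matrix.diagonal g * (dftMatrix d)ᴴ) = dftMatrix d * (Matrix.diagonal f *
      ((dftMatrix d)ᴴ * dftMatrix d) * Matrix.diagonal g) * (dftMatrix d)ᴴ by
    simp only [Matrix.mul_assoc], dftMatrix_conjTranspose_mul, Matrix.mul_one,
    Matrix.diagonal_mul_diagonal]
  rfl

lemma spectralCirculant_conjTranspose (f : ZMod d → ℂ) :
    (spectralCirculant f)ᴴ = spectralCirculant (star f) := by
  simp [spectralCirculant, Matrix.conjTranspose_mul, Matrix.diagonal_conjTranspose,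
    Matrix.mul_assoc]

lemma spectralCirculant_one : spectralCirculant (1 : ZMod d → ℂ) = 1 := by
  rw [spectralCirculant, show Matrix.diagonal (1 : ZMod d → ℂ) = 1 from Matrix.diagonal_one,
    Matrix.mul_one, dftMatrix_mul_conjTranspose]

lemma spectralCirculant_add (f g : ZMod d → ℂ) :
    spectralCirculant (f + g) = spectralCirculant f + spectralCirculant g := by
  simp only [spectralCirculant, ← Matrix.add_mul, ← Matrix.mul_add, Matrix.diagonal_add]
  rfl

lemma spectralCirculant_sub (f g : ZMod d → ℂ) :
    spectralCirculant (f - g) = spectralCirculant f - spectralCirculant g := by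
  simp only [spectralCirculant, ← Matrix.sub_mul, ← Matrix.mul_sub, Matrix.diagonal_sub]
  rfl

lemma spectralCirculant_injective :
    Function.Injective (spectralCirculant : (ZMod d → ℂ) → Matrix (ZMod d) (ZMod d) ℂ) := by
  intro f g h
  have key : ∀ f : ZMod d → ℂ,
      (dftMatrix d)ᴴ * spectralCirculant f * dftMatrix d = Matrix.diagonal f := fun f => by
    rw [spectralCirculant, show (dftMatrix d)ᴴ * (dftMatrix d * Matrix.diagonal f *
      (dftMatrix d)ᴴ) * dftMatrix d = ((dftMatrix d)ᴴ * dftMatrix d) * Matrix.diagonal f *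
      ((dftMatrix d)ᴴ * dftMatrix d) by simp only [Matrix.mul_assoc],
      dftMatrix_conjTranspose_mul, Matrix.one_mul, Matrix.mul_one]
  exact Matrix.diagonal_injective (by rw [← key f, ← key g, h])

lemma spectralCirculant_eq_circulant (f : ZMod d → ℂ) :
    ∃ v, spectralCirculant f = Matrix.circulant v := by
  refine ⟨fun t => ∑ k, (d : ℂ)⁻¹ * f k * ZMod.stdAddChar (t * k), ?_⟩
  ext i j
  rw [spectralCirculant, Matrix.mul_apply]
  simp only [Matrix.mul_diagonal, Matrix.circulant_apply, Matrix.conjTranspose_apply]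
  refine Finset.sum_congr rfl fun k _ => ?_
  simp only [dftMatrix, Matrix.of_apply, star_mul', star_stdAddChar]
  rw [sub_mul, sub_eq_add_neg, AddChar.map_add_eq_mul, ← inv_sqrt_mul_inv_sqrt]
  simp
  ring

/-- The characters of ℤ/d are eigenvectors of every circulant matrix; the eigenvalues are the
Fourier coefficients of v. -/
lemma circulant_eq_spectralCirculant (v : ZMod d → ℂ) :
    ∃ f, Matrix.circulant v = spectralCirculant f := by
  refine ⟨fun k => ∑ t, v t * ZMod.stdAddChar (-(t * k)), ?_⟩
  have h : Matrix.circulant v * dftMatrix d = dftMatrix d * Matrix.diagonal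
      (fun k => ∑ t, v t * ZMod.stdAddChar (-(t * k))) := by
    ext i k
    rw [Matrix.mul_diagonal, Matrix.mul_apply, Finset.mul_sum]
    refine Fintype.sum_equiv (Equiv.subLeft i) _ _ fun j => ?_
    simp only [Matrix.circulant_apply, dftMatrix, Matrix.of_apply, Equiv.subLeft_apply]
    rw [show j * k = i * k + -((i - j) * k) by ring, AddChar.map_add_eq_mul]
    ring
  rw [spectralCirculant, ← h, Matrix.mul_assoc, dftMatrix_mul_conjTranspose, Matrix.mul_one]

/-- The Hermitian matrix [1+f, g; ḡ, 1-f] has trace 2 and determinant 1 - f² - |g|² = 0, so it is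
positive semidefinite of rank one and equals (a, b)*(a, b). -/
lemma exists_factor_two_by_two (f : ℝ) (g : ℂ) (h : f ^ 2 + ‖g‖ ^ 2 = 1) :
    ∃ a b : ℂ, star a * a = 1 + f ∧ star a * b = g ∧ star b * b = 1 - f := by
  have hf : 0 ≤ 1 + f := by nlinarith [sq_nonneg ‖g‖]
  rcases hf.eq_or_lt with h0 | hpos
  -- Here a = 0 and dividing g by it is impossible, but f = -1 forces g = 0 and any b with |b|² = 2
  -- works.
  · have hf1 : f = -1 := by linarith
    have hg : g = 0 := by
      subst hf1
      have : ‖g‖ ^ 2 = 0 := by linarith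
      simpa using this
    refine ⟨0, (√2 : ℝ), ?_, ?_, ?_⟩
    · simp [hf1]
    · simp [hg]
    · rw [RCLike.star_def, Complex.conj_ofReal, ← Complex.ofReal_mul,
        Real.mul_self_sqrt zero_le_two, hf1]
      norm_num
  · have hs : ((√(1 + f) : ℝ) : ℂ) * (√(1 + f) : ℝ) = 1 + f := by
      rw [← Complex.ofReal_mul, Real.mul_self_sqrt hf]; simp
    have hs0 : ((√(1 + f) : ℝ) : ℂ) ≠ 0 := by
      exact_mod_cast (Real.sqrt_pos.2 hpos).ne'
    refine ⟨(√(1 + f) : ℝ), g / (√(1 + f) : ℝ), ?_, ?_, ?_⟩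
    · rw [RCLike.star_def, Complex.conj_ofReal, hs]
    · rw [RCLike.star_def, Complex.conj_ofReal]; field_simp
    · rw [RCLike.star_def, map_div₀, Complex.conj_ofReal, div_mul_div_comm, hs, Complex.conj_mul']
      have h1 : (1 + f : ℂ) ≠ 0 := by exact_mod_cast hpos.ne'
      have h2 : (f : ℂ) ^ 2 + (‖g‖ : ℂ) ^ 2 = 1 := by exact_mod_cast h
      rw [div_eq_iff h1]
      linear_combination h2

/-- The `2 × 2` block projection with circulant blocks `(1 ± X)/2`, `Y/2` is the Gram matrix of a
pair of circulant matrices, up to scaling. -/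
lemma exists_circulant_factor (x y : ZMod d → ℂ)
    (hx : (Matrix.circulant x)ᴴ = Matrix.circulant x)
    (h : Matrix.circulant x * Matrix.circulant x +
      Matrix.circulant y * (Matrix.circulant y)ᴴ = 1) :
    ∃ u v : ZMod d → ℂ,
      (Matrix.circulant u)ᴴ * Matrix.circulant u = 1 + Matrix.circulant x ∧
      (Matrix.circulant u)ᴴ * Matrix.circulant v = Matrix.circulant y ∧
      (Matrix.circulant v)ᴴ * Matrix.circulant v = 1 - Matrix.circulant x := by
  obtain ⟨f, hf⟩ := circulant_eq_spectralCirculant x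
  obtain ⟨g, hg⟩ := circulant_eq_spectralCirculant y
  rw [hf, hg] at h
  rw [hf, spectralCirculant_conjTranspose] at hx
  rw [spectralCirculant_conjTranspose, spectralCirculant_mul, spectralCirculant_mul,
    ← spectralCirculant_add, ← spectralCirculant_one] at h
  have hfr := spectralCirculant_injective hx
  have hfg := spectralCirculant_injective h
  have hre : ∀ k, ((f k).re : ℂ) = f k := fun k =>
    Complex.conj_eq_iff_re.1 (congrFun hfr k)
  have hpt : ∀ k, ∃ ab : ℂ × ℂ, star ab.1 * ab.1 = 1 + f k ∧ star ab.1 * ab.2 = g k ∧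
      star ab.2 * ab.2 = 1 - f k := fun k => by
    have h1 := congrFun hfg k
    simp only [Pi.add_apply, Pi.mul_apply, Pi.star_apply, Pi.one_apply, RCLike.star_def,
      Complex.mul_conj'] at h1
    rw [← hre k] at h1
    obtain ⟨a, b, h2⟩ := exists_factor_two_by_two (f k).re (g k) (by
      rw [sq]; exact_mod_cast h1)
    rw [hre k] at h2
    exact ⟨(a, b), h2⟩
  choose ab h1 h2 h3 using hpt
  obtain ⟨u, hu⟩ := spectralCirculant_eq_circulant fun k => (ab k).1
  obtain ⟨v, hv⟩ := spectralCirculant_eq_circulant fun k => (ab k).2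
  refine ⟨u, v, ?_, ?_, ?_⟩
  · rw [← hu, hf, spectralCirculant_conjTranspose, spectralCirculant_mul, ← spectralCirculant_one,
      ← spectralCirculant_add]
    exact congrArg _ (funext h1)
  · rw [← hu, ← hv, hg, spectralCirculant_conjTranspose, spectralCirculant_mul]
    exact congrArg _ (funext h2)
  · rw [← hv, hf, spectralCirculant_conjTranspose, spectralCirculant_mul, ← spectralCirculant_one,
      ← spectralCirculant_sub]
    exact congrArg _ (funext h3)

end Circulant

/-! ### The criterion for switching to a 2-circulant frame -/

section Criterion

variable {d : ℕ} {ι : Type*} [Fintype ι] [DecidableEq ι]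

lemma gram_fromCols (u v x y : Matrix (Fin d) (Fin d) ℂ) (h1 : uᴴ * u = 1 + x)
    (h2 : uᴴ * v = y) (h3 : vᴴ * v = 1 - x) :
    (Matrix.fromCols u v)ᴴ * Matrix.fromCols u v
      = 1 + Matrix.fromBlocks x y yᴴ (-x) := by
  have h4 : vᴴ * u = yᴴ := by
    rw [← h2, Matrix.conjTranspose_mul, Matrix.conjTranspose_conjTranspose]
  rw [Matrix.conjTranspose_fromCols_eq_fromRows_conjTranspose,
    Matrix.fromRows_mul_fromCols, h1, h2, h3, h4, ← Matrix.fromBlocks_one, Matrix.fromBlocks_add,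
    zero_add, zero_add, sub_eq_add_neg]

lemma exists_circulant_factor_fin (hd : 0 < d) (x y : Fin d → ℂ)
    (hx : (Matrix.circulant x)ᴴ = Matrix.circulant x)
    (h : Matrix.circulant x * Matrix.circulant x +
      Matrix.circulant y * (Matrix.circulant y)ᴴ = 1) :
    ∃ u v : Fin d → ℂ,
      (Matrix.circulant u)ᴴ * Matrix.circulant u = 1 + Matrix.circulant x ∧
      (Matrix.circulant u)ᴴ * Matrix.circulant v = Matrix.circulant y ∧
      (Matrix.circulant v)ᴴ * Matrix.circulant v = 1 - Matrix.circulant x := by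
  obtain ⟨m, rfl⟩ : ∃ m, d = m + 1 := ⟨d - 1, by omega⟩
  -- `ZMod (m + 1)` is by definition `Fin (m + 1)`, with the same subtraction.
  exact exists_circulant_factor (d := m + 1) x y hx h

lemma exists_twoCirculant_factor (hd : 0 < d) (x y : Fin d → ℂ)
    (hx : (Matrix.circulant x)ᴴ = Matrix.circulant x)
    (h : Matrix.circulant x * Matrix.circulant x +
      Matrix.circulant y * (Matrix.circulant y)ᴴ = (2 * d - 1 : ℂ) • 1) :
    ∃ u v : Fin d → ℂ,
      (Matrix.fromCols (Matrix.circulant u) (Matrix.circulant v))ᴴ *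
        Matrix.fromCols (Matrix.circulant u) (Matrix.circulant v) =
      1 + ((√(2 * d - 1) : ℝ)⁻¹ : ℂ) • Matrix.fromBlocks (Matrix.circulant x) (Matrix.circulant y)
        (Matrix.circulant y)ᴴ (-Matrix.circulant x) := by
  set γ : ℂ := ((√(2 * d - 1) : ℝ)⁻¹ : ℂ) with hγ
  have hd1 : (1 : ℝ) ≤ d := by exact_mod_cast hd
  have hγs : star γ = γ := by simp [hγ]
  have hγ2 : γ * γ * (2 * d - 1 : ℂ) = 1 := by
    have h1 : (2 * d - 1 : ℝ) ≠ 0 := by linarith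
    rw [hγ, ← mul_inv, ← Complex.ofReal_mul, Real.mul_self_sqrt (by linarith)]
    have h2 : ((2 * d - 1 : ℝ) : ℂ) ≠ 0 := by exact_mod_cast h1
    rw [show (2 * d - 1 : ℂ) = ((2 * d - 1 : ℝ) : ℂ) by push_cast; rfl]
    exact inv_mul_cancel₀ h2
  obtain ⟨u, v, h1, h2, h3⟩ := exists_circulant_factor_fin hd (γ • x) (γ • y)
    (by rw [Matrix.circulant_smul, Matrix.conjTranspose_smul, hγs, hx])
    (by
      rw [Matrix.circulant_smul, Matrix.circulant_smul, Matrix.conjTranspose_smul, hγs]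
      simp only [Matrix.smul_mul, Matrix.mul_smul, smul_smul, ← smul_add]
      rw [h, smul_smul, hγ2, one_smul])
  refine ⟨u, v, ?_⟩
  rw [gram_fromCols _ _ _ _ h1 h2 h3, Matrix.circulant_smul, Matrix.circulant_smul,
    Matrix.conjTranspose_smul, hγs, Matrix.fromBlocks_smul, smul_neg]

/-- Identification of two copies of `α` with `Fin 2 × α`. -/
def finTwoProdEquivSum (α : Type*) : Fin 2 × α ≃ α ⊕ α :=
  (finTwoEquiv.prodCongr (Equiv.refl α)).trans (Equiv.boolProdEquivSum α)

/-- A Hermitian signature matrix `S` with `S² = (2d - 1) I` that can be reindexed and switched to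
the form `[X, Y; Y*, -X]` with circulant blocks is the signature matrix of a `2`-circulant ETF. -/
theorem switchesToTwoCirculantETF_of_circulant_blocks (hd : 0 < d) {S : Matrix ι ι ℂ}
    (hdiag : ∀ j, S j j = 0) (huni : ∀ j k, j ≠ k → ‖S j k‖ = 1) (hH : Sᴴ = S)
    (hS : S * S = (2 * d - 1 : ℂ) • (1 : Matrix ι ι ℂ))
    (e : Fin d ⊕ Fin d ≃ ι) (c : Fin d ⊕ Fin d → ℂ) (hc : ∀ a, ‖c a‖ = 1) (x y : Fin d → ℂ)
    (h11 : ∀ i j, star (c (.inl i)) * S (e (.inl i)) (e (.inl j)) * c (.inl j) = x (i - j))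
    (h12 : ∀ i j, star (c (.inl i)) * S (e (.inl i)) (e (.inr j)) * c (.inr j) = y (i - j))
    (h22 : ∀ i j, star (c (.inr i)) * S (e (.inr i)) (e (.inr j)) * c (.inr j) = - x (i - j)) :
    SwitchesToTwoCirculantETF d S := by
  have hcard : Fintype.card ι = 2 * d := by
    rw [← Fintype.card_congr e, Fintype.card_sum, Fintype.card_fin, two_mul]
  have hcc : ∀ a, c a * star (c a) = 1 := fun a => by
    rw [RCLike.star_def, Complex.mul_conj', hc]; simp
  have hherm : ∀ a b, star (S a b) = S b a := fun a b => congrFun (congrFun hH b) a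
  set S' : Matrix (Fin d ⊕ Fin d) (Fin d ⊕ Fin d) ℂ := Matrix.fromBlocks (Matrix.circulant x)
    (Matrix.circulant y) (Matrix.circulant y)ᴴ (-Matrix.circulant x) with hS'
  have hS'S : ∀ a b, star (c a) * S (e a) (e b) * c b = S' a b := by
    rintro (i | i) (j | j)
    · exact h11 i j
    · exact h12 i j
    · simp only [hS', Matrix.fromBlocks_apply₂₁, Matrix.conjTranspose_apply,
        Matrix.circulant_apply, ← h12, star_mul', star_star, hherm]
      ring
    · exact h22 i j
  have hx : (Matrix.circulant x)ᴴ = Matrix.circulant x := by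
    ext i j
    simp only [Matrix.conjTranspose_apply, Matrix.circulant_apply, ← h11, star_mul', star_star,
      hherm]
    ring
  have hS'2 : S' * S' = (2 * d - 1 : ℂ) • (1 : Matrix _ _ ℂ) := by
    ext a b
    rw [Matrix.mul_apply]
    have h1 : ∀ k, S' a k * S' k b = star (c a) * (S (e a) (e k) * S (e k) (e b)) * c b :=
      fun k => by
        rw [← hS'S, ← hS'S]
        linear_combination (star (c a) * S (e a) (e k) * S (e k) (e b) * c b) * hcc k
    simp only [h1, ← Finset.sum_mul, ← Finset.mul_sum]
    rw [Equiv.sum_comp e fun k => S (e a) k * S k (e b), ← Matrix.mul_apply, hS,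
      Matrix.smul_apply, Matrix.smul_apply]
    by_cases hab : a = b
    · subst hab
      rw [Matrix.one_apply_eq, Matrix.one_apply_eq, mul_right_comm, mul_comm (star _), hcc]
      simp
    · rw [Matrix.one_apply_ne hab, Matrix.one_apply_ne (e.injective.ne hab)]
      simp
  -- The upper left block of S'² = (2d-1)I is X² + YY*.
  obtain ⟨u, v, huv⟩ := exists_twoCirculant_factor hd x y hx (by
    have := congrArg Matrix.toBlocks₁₁ hS'2
    rw [hS', Matrix.fromBlocks_multiply, Matrix.toBlocks_fromBlocks₁₁] at this
    rw [this, ← Matrix.fromBlocks_one, Matrix.fromBlocks_smul, Matrix.toBlocks_fromBlocks₁₁])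
  rw [← hS'] at huv
  set Θ := Matrix.fromCols (Matrix.circulant u) (Matrix.circulant v) with hΘ
  have hd1 : (1 : ℝ) ≤ d := by exact_mod_cast hd
  have hγ : 0 < (√(2 * d - 1))⁻¹ := inv_pos.2 (Real.sqrt_pos.2 (by linarith))
  have hγ2 : (((√(2 * d - 1))⁻¹ : ℝ) : ℂ) ^ 2 * (2 * d - 1) = 1 := by
    have h1 : (2 * d - 1 : ℝ) ≠ 0 := by linarith
    rw [← Complex.ofReal_pow, inv_pow, Real.sq_sqrt (by linarith)]
    have h2 : ((2 * d - 1 : ℝ) : ℂ) ≠ 0 := by exact_mod_cast h1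
    rw [show (2 * d - 1 : ℂ) = ((2 * d - 1 : ℝ) : ℂ) by push_cast; rfl, Complex.ofReal_inv]
    exact inv_mul_cancel₀ h2
  rw [← Complex.ofReal_inv] at huv
  have hent : ∀ a b, (Θᴴ * Θ) a b
      = star (c a) * (1 + (((√(2 * d - 1))⁻¹ : ℝ) : ℂ) • S) (e a) (e b) * c b := fun a b => by
    rw [huv, Matrix.add_apply, Matrix.add_apply, Matrix.smul_apply, Matrix.smul_apply, ← hS'S]
    by_cases hab : a = b
    · subst hab
      rw [Matrix.one_apply_eq, Matrix.one_apply_eq, smul_eq_mul, smul_eq_mul]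
      linear_combination -hcc a
    · rw [Matrix.one_apply_ne hab, Matrix.one_apply_ne (e.injective.ne hab), smul_eq_mul,
        smul_eq_mul]
      ring
  constructor
  -- Undoing the switching on the 2-circulant frame Θ gives a frame with signature matrix S itself.
  · refine ⟨Matrix.of fun i j => Θ i (e.symm j) * star (c (e.symm j)),
      isETF_hasSignature_of_gram hdiag huni hcard hγ (by rw [hS, smul_smul, hγ2, one_smul]) ?_⟩
    ext j k
    have h1 : ((Matrix.of fun i j => Θ i (e.symm j) * star (c (e.symm j)))ᴴ *
        (Matrix.of fun i j => Θ i (e.symm j) * star (c (e.symm j)))) j k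
        = c (e.symm j) * (Θᴴ * Θ) (e.symm j) (e.symm k) * star (c (e.symm k)) := by
      simp only [Matrix.mul_apply, Matrix.conjTranspose_apply, Matrix.of_apply, star_mul',
        star_star, Finset.mul_sum, Finset.sum_mul]
      exact Finset.sum_congr rfl fun i _ => by ring
    rw [h1, hent, e.apply_symm_apply, e.apply_symm_apply]
    linear_combination ((1 + (((√(2 * d - 1))⁻¹ : ℝ) : ℂ) • S) j k *
      (c (e.symm k) * star (c (e.symm k)))) * hcc (e.symm j) +
      ((1 + (((√(2 * d - 1))⁻¹ : ℝ) : ℂ) • S) j k) * hcc (e.symm k)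
  · intro Φ hΦ hΦS
    obtain ⟨ht, hG⟩ := hΦS.tight_gram hd hcard hS hΦ
    rw [← Complex.ofReal_inv] at hG
    -- Conversely, switching a given Φ yields the Gram matrix of Θ, so the two differ by a unitary.
    set Φ' : Matrix (Fin d) (Fin d ⊕ Fin d) ℂ := Matrix.of fun i a => Φ i (e a) * c a with hΦ'
    have hgram : Φ'ᴴ * Φ' = Θᴴ * Θ := by
      ext a b
      rw [hent, ← hG]
      simp only [hΦ', Matrix.mul_apply, Matrix.conjTranspose_apply, Matrix.of_apply, star_mul',
        Finset.mul_sum, Finset.sum_mul]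
      exact Finset.sum_congr rfl fun i _ => by ring
    have hframe : Φ' * Φ'ᴴ = (2 : ℂ) • (1 : Matrix (Fin d) (Fin d) ℂ) := by
      rw [← ht]
      ext i k
      simp only [hΦ', Matrix.mul_apply, Matrix.conjTranspose_apply, Matrix.of_apply, star_mul']
      rw [← Equiv.sum_comp e]
      exact Finset.sum_congr rfl fun a _ => by
        linear_combination (Φ i (e a) * star (Φ k (e a))) * hcc a
    obtain ⟨U, hU, hUΘ⟩ := exists_unitary_of_gram_eq hgram hframe
    set p := finTwoProdEquivSum (Fin d) with hp
    set s := (p.trans e) with hs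
    refine ⟨Θ.submatrix id p, ?_, ?_, U, hU, s.symm, fun j => star (c (e.symm j)), ?_, ?_⟩
    · have hcp : Fintype.card (Fin 2 × Fin d) = 2 * d := by simp
      have hnorm : ∀ a b, ‖S' a b‖ = ‖S (e a) (e b)‖ := fun a b => by
        rw [← hS'S, norm_mul, norm_mul, norm_star, hc, hc, one_mul, mul_one]
      refine (isETF_hasSignature_of_gram (S := S'.submatrix p p) (fun j => ?_) (fun j k hjk => ?_)
        hcp hγ ?_ ?_).1
      · rw [Matrix.submatrix_apply, ← hS'S, hdiag]; simp
      · rw [Matrix.submatrix_apply, hnorm]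
        exact huni _ _ ((p.trans e).injective.ne hjk)
      · rw [Matrix.submatrix_mul_equiv, hS'2, Matrix.submatrix_smul, Pi.smul_apply, Pi.smul_apply,
          Matrix.submatrix_one_equiv, smul_smul, hγ2, one_smul]
      · rw [Matrix.conjTranspose_submatrix, ← Matrix.submatrix_mul _ _ _ _ _ Function.bijective_id,
          huv, Matrix.submatrix_add, Pi.add_apply, Pi.add_apply, Matrix.submatrix_smul,
          Pi.smul_apply, Pi.smul_apply, Matrix.submatrix_one_equiv]
    · intro k
      fin_cases k
      · exact ⟨u, rfl⟩
      · exact ⟨v, rfl⟩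
    · intro j
      rw [norm_star, hc]
    · intro i j
      have h1 : (U * Θ.submatrix id p) i (s.symm j) = (U * Θ) i (e.symm j) := by
        simp [Matrix.mul_apply, hs]
      rw [h1, ← hUΘ, hΦ', Matrix.of_apply, e.apply_symm_apply]
      linear_combination -(Φ i j) * hcc (e.symm j)

end Criterion

/-! ### Doubling a signature matrix -/

section Double

variable {ι : Type*} [Fintype ι] [DecidableEq ι]

lemma norm_eq_one_of_mul_star {z : ℂ} (h : z * star z = 1) : ‖z‖ = 1 := by
  rw [RCLike.star_def, Complex.mul_conj'] at h
  have h1 : ‖z‖ ^ 2 = 1 := by exact_mod_cast h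
  nlinarith [norm_nonneg z]

lemma mul_star_of_norm_eq_one {z : ℂ} (h : ‖z‖ = 1) : z * star z = 1 := by
  rw [RCLike.star_def, Complex.mul_conj', h]; simp

lemma units_int_cast_mul_self (ε : ℤˣ) : ((ε : ℤ) : ℂ) * ((ε : ℤ) : ℂ) = 1 := by
  rcases Int.units_eq_one_or ε with rfl | rfl <;> simp

lemma star_doublingBeta (d n : ℕ) (ε : ℤˣ) : star (doublingBeta d n ε) =
    -(doublingConst d n : ℂ) - ((ε : ℤ) : ℂ) * Complex.I * (√(1 - doublingConst d n ^ 2) : ℝ) := by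
  simp [doublingBeta, ← sub_eq_add_neg]

lemma doublingBeta_add_star (d n : ℕ) (ε : ℤˣ) :
    doublingBeta d n ε + star (doublingBeta d n ε) = -2 * (doublingConst d n : ℂ) := by
  rw [star_doublingBeta, doublingBeta]; ring

lemma doublingBeta_mul_star {d n : ℕ} (ε : ℤˣ) (hc : doublingConst d n ^ 2 ≤ 1) :
    doublingBeta d n ε * star (doublingBeta d n ε) = 1 := by
  have h : ((√(1 - doublingConst d n ^ 2) : ℝ) : ℂ) * (√(1 - doublingConst d n ^ 2) : ℝ)
      = 1 - (doublingConst d n : ℂ) ^ 2 := by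
    rw [← Complex.ofReal_mul, Real.mul_self_sqrt (by linarith)]; simp
  rw [star_doublingBeta, doublingBeta]
  linear_combination h - ((√(1 - doublingConst d n ^ 2) : ℝ) : ℂ) *
    (√(1 - doublingConst d n ^ 2) : ℝ) * (((ε : ℤ) : ℂ) * ((ε : ℤ) : ℂ)) * Complex.I_sq +
    ((√(1 - doublingConst d n ^ 2) : ℝ) : ℂ) * (√(1 - doublingConst d n ^ 2) : ℝ) *
      units_int_cast_mul_self ε

variable {d : ℕ} {S : Matrix ι ι ℂ}

lemma doubleSignature_conjTranspose (ε : ℤˣ) (hH : Sᴴ = S) :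
    (doubleSignature d ε S)ᴴ = doubleSignature d ε S := by
  rw [doubleSignature, Matrix.fromBlocks_conjTranspose]
  simp [hH, Matrix.conjTranspose_add, Matrix.conjTranspose_smul]

lemma doubleSignature_diag (ε : ℤˣ) (hdiag : ∀ j, S j j = 0) (a : ι ⊕ ι) :
    doubleSignature d ε S a a = 0 := by
  rcases a with a | a <;> simp [doubleSignature, hdiag]

lemma norm_doubleSignature (ε : ℤˣ) (hc : doublingConst d (Fintype.card ι) ^ 2 ≤ 1)
    (hdiag : ∀ j, S j j = 0) (huni : ∀ j k, j ≠ k → ‖S j k‖ = 1) (a b : ι ⊕ ι) (hab : a ≠ b) :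
    ‖doubleSignature d ε S a b‖ = 1 := by
  have hβ := norm_eq_one_of_mul_star (doublingBeta_mul_star ε hc)
  rcases a with a | a <;> rcases b with b | b
  · simpa [doubleSignature] using huni a b (by simpa using hab)
  · by_cases h : a = b
    · simp [doubleSignature, h, hdiag, hβ]
    · simpa [doubleSignature, h] using huni a b h
  · by_cases h : a = b
    · simp [doubleSignature, h, hdiag, hβ]
    · simpa [doubleSignature, h] using huni a b h
  · simpa [doubleSignature] using huni a b (by simpa using hab)

/-- The diagonal blocks of the square are 2S² + (β+β̄)S + |β|²I. The choice Re β = -c cancels the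
term 2cS coming from 2S², and |β| = 1 leaves 2(n-1) + 1. The off-diagonal blocks cancel because S
commutes with S + βI. -/
lemma doubleSignature_mul_self (ε : ℤˣ) (hc : doublingConst d (Fintype.card ι) ^ 2 ≤ 1)
    (hS : S * S = (Fintype.card ι - 1 : ℂ) • (1 : Matrix ι ι ℂ) +
      (doublingConst d (Fintype.card ι) : ℂ) • S) :
    doubleSignature d ε S * doubleSignature d ε S =
      (2 * Fintype.card ι - 1 : ℂ) • (1 : Matrix (ι ⊕ ι) (ι ⊕ ι) ℂ) := by
  have h1 := doublingBeta_add_star d (Fintype.card ι) ε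
  have h2 := doublingBeta_mul_star ε hc
  rw [doubleSignature, Matrix.fromBlocks_multiply, ← Matrix.fromBlocks_one, Matrix.fromBlocks_smul]
  generalize doublingBeta d (Fintype.card ι) ε = β at *
  generalize hb : star β = β' at *
  generalize (doublingConst d (Fintype.card ι) : ℂ) = c at *
  generalize (Fintype.card ι : ℂ) = n at *
  have key : S * S + (S + β • (1 : Matrix ι ι ℂ)) * (S + β' • (1 : Matrix ι ι ℂ)) =
      (2 * n - 1) • 1 := by
    have : S * S + (S + β • (1 : Matrix ι ι ℂ)) * (S + β' • (1 : Matrix ι ι ℂ)) =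
        (2 : ℂ) • (S * S) + (β + β') • S + (β * β') • 1 := by
      simp only [add_mul, mul_add, Matrix.smul_mul, Matrix.mul_smul, Matrix.mul_one,
        Matrix.one_mul, smul_smul]
      module
    rw [this, hS, h1, h2]
    module
  congr 1
  · simp only [mul_add, add_mul, mul_neg, Matrix.smul_mul, Matrix.mul_smul, Matrix.mul_one,
      Matrix.one_mul, smul_zero]
    abel
  · simp only [mul_add, add_mul, neg_mul, Matrix.smul_mul, Matrix.mul_smul, Matrix.mul_one,
      Matrix.one_mul, smul_zero]
    abel
  · rw [← key]
    simp only [mul_add, add_mul, neg_mul, mul_neg, neg_neg, Matrix.smul_mul, Matrix.mul_smul,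
      Matrix.mul_one, Matrix.one_mul, smul_smul, mul_comm β β']
    abel

end Double

/-! ### The quadratic character and the Paley conference matrix -/

section Paley

variable {F : Type*} [Field F]

lemma paleySeidel_apply [Fintype F] [DecidableEq F] (a b : F) :
    paleySeidel F a b = ((quadraticChar F (a - b) : ℤ) : ℂ) := by
  simp only [paleySeidel, Matrix.of_apply, PaleyAdj, quadraticChar_apply, quadraticCharFun,
    sub_eq_zero]
  by_cases h : a = b
  · simp [h]
  · by_cases h2 : IsSquare (a - b) <;> simp [h, h2, sub_eq_zero]

/-- Representatives `(1, 0)` and `(a, 1)` of the points of the projective line. -/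
def projectiveRep : Unit ⊕ F → F × F := Sum.elim (fun _ => (1, 0)) fun a => (a, 1)

/-- The determinant of a pair of vectors of the plane. -/
def pairDet (x y : F × F) : F := x.1 * y.2 - x.2 * y.1

lemma pairDet_swap (x y : F × F) : pairDet y x = -pairDet x y := by
  simp only [pairDet]; ring

lemma pairDet_projectiveRep_eq_zero {a b : Unit ⊕ F} :
    pairDet (projectiveRep a) (projectiveRep b) = 0 ↔ a = b := by
  rcases a with a | a <;> rcases b with b | b <;> simp [pairDet, projectiveRep, sub_eq_zero]

variable [Fintype F]

lemma ringChar_ne_two_of_odd_card (hF : Odd (Fintype.card F)) : ringChar F ≠ 2 := fun h => by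
  exact Nat.not_even_iff_odd.2 hF (Nat.even_iff.2 (FiniteField.even_card_iff_char_two.1 h))

variable [DecidableEq F]

lemma quadraticChar_neg_one_eq (hF : Odd (Fintype.card F)) :
    quadraticChar F (-1) = if Fintype.card F % 4 = 1 then 1 else -1 := by
  have h1 : (-1 : F) ≠ 0 := by simp
  have h4 := Nat.odd_iff.1 hF
  split_ifs with h
  · rw [quadraticChar_one_iff_isSquare h1, FiniteField.isSquare_neg_one_iff]
    omega
  · rw [quadraticChar_neg_one_iff_not_isSquare, FiniteField.isSquare_neg_one_iff]
    omega

lemma quadraticChar_neg (a : F) : quadraticChar F (-a) = quadraticChar F (-1) * quadraticChar F a := by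
  rw [← map_mul, neg_one_mul]

lemma quadraticChar_neg_one_mul_self : quadraticChar F (-1) * quadraticChar F (-1) = 1 := by
  rw [← map_mul]; simp

lemma quadraticChar_mul_self {a : F} (ha : a ≠ 0) : quadraticChar F a * quadraticChar F a = 1 := by
  rw [← sq, quadraticChar_sq_one ha]

/-- For a ≠ c the substitution b = (a-c)u + c turns the sum into the Jacobi sum J(χ, χ) = J(χ, χ⁻¹)
= -χ(-1). For a = c each of the q-1 nonzero terms is χ(-1). -/
lemma sum_quadraticChar_mul (hF : Odd (Fintype.card F)) (a c : F) :
    ∑ b, quadraticChar F (a - b) * quadraticChar F (b - c) =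
      quadraticChar F (-1) * (Fintype.card F * (if a = c then 1 else 0) - 1) := by
  have hχ := quadraticChar_ne_one (ringChar_ne_two_of_odd_card hF)
  by_cases hac : a = c
  · subst hac
    have h : ∀ b, quadraticChar F (a - b) * quadraticChar F (b - a) =
        quadraticChar F (-1) * (1 - if b = a then 1 else 0) := fun b => by
      rw [← neg_sub a b, quadraticChar_neg]
      by_cases hb : b = a
      · simp [hb]
      · rw [mul_left_comm, quadraticChar_mul_self (sub_ne_zero.2 (Ne.symm hb))]
        simp [hb]
    simp only [h, ← Finset.mul_sum, Finset.sum_sub_distrib]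
    simp
  · have hac' : a - c ≠ 0 := sub_ne_zero.2 hac
    have h := jacobiSum_nontrivial_inv hχ
    rw [(quadraticChar_isQuadratic F).inv, jacobiSum] at h
    rw [← Equiv.sum_comp ((Equiv.mulLeft₀ (a - c) hac').trans (Equiv.addRight c))]
    have h2 : ∀ u, quadraticChar F (a - ((Equiv.mulLeft₀ (a - c) hac').trans (Equiv.addRight c)) u) *
        quadraticChar F (((Equiv.mulLeft₀ (a - c) hac').trans (Equiv.addRight c)) u - c) =
        quadraticChar F u * quadraticChar F (1 - u) := fun u => by
      have h3 : ((Equiv.mulLeft₀ (a - c) hac').trans (Equiv.addRight c)) u = (a - c) * u + c := rfl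
      rw [h3, show a - ((a - c) * u + c) = (a - c) * (1 - u) by ring, add_sub_cancel_right, map_mul,
        map_mul]
      linear_combination (quadraticChar F u * quadraticChar F (1 - u)) *
        quadraticChar_mul_self hac'
    simp only [h2, h, if_neg hac]
    ring

/-- The sign `χ(-1)` as a complex number. -/
noncomputable def negOneSign (F : Type*) [Field F] [Fintype F] [DecidableEq F] : ℂ :=
  ((quadraticChar F (-1) : ℤ) : ℂ)

lemma negOneSign_mul_self : negOneSign F * negOneSign F = 1 := by
  rw [negOneSign, ← Int.cast_mul, quadraticChar_neg_one_mul_self, Int.cast_one]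

lemma paleySeidel_mul_self (hF : Odd (Fintype.card F)) :
    paleySeidel F * paleySeidel F =
      negOneSign F • ((Fintype.card F : ℂ) • 1 - Matrix.of fun _ _ => 1) := by
  ext a c
  simp only [Matrix.mul_apply, paleySeidel_apply, ← Int.cast_mul, ← Int.cast_sum,
    sum_quadraticChar_mul hF, negOneSign]
  by_cases h : a = c <;> simp [h]

lemma paleySeidel_mul_ones (hF : Odd (Fintype.card F)) {κ : Type*} :
    paleySeidel F * (Matrix.of fun _ _ => 1 : Matrix F κ ℂ) = 0 := by
  ext a c
  simp only [Matrix.mul_apply, paleySeidel_apply, Matrix.of_apply, mul_one, ← Int.cast_sum]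
  rw [← Equiv.sum_comp (Equiv.subLeft a)]
  simp only [Equiv.subLeft_apply, sub_sub_cancel,
    quadraticChar_sum_zero (ringChar_ne_two_of_odd_card hF), Int.cast_zero, Matrix.zero_apply]

lemma ones_mul_paleySeidel (hF : Odd (Fintype.card F)) {κ : Type*} :
    (Matrix.of fun _ _ => 1 : Matrix κ F ℂ) * paleySeidel F = 0 := by
  ext a c
  simp only [Matrix.mul_apply, paleySeidel_apply, Matrix.of_apply, one_mul, ← Int.cast_sum]
  rw [← Equiv.sum_comp (Equiv.addRight c)]
  simp only [Equiv.coe_addRight, add_sub_cancel_right,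
    quadraticChar_sum_zero (ringChar_ne_two_of_odd_card hF), Int.cast_zero, Matrix.zero_apply]

lemma paleySeidel_swap (a b : F) : paleySeidel F b a = negOneSign F * paleySeidel F a b := by
  rw [paleySeidel_apply, paleySeidel_apply, negOneSign, ← neg_sub a b, quadraticChar_neg,
    Int.cast_mul]

lemma star_paleySeidel (a b : F) : star (paleySeidel F a b) = paleySeidel F a b := by
  rw [paleySeidel_apply]; simp

lemma paleySeidel_diag (a : F) : paleySeidel F a a = 0 := by simp [paleySeidel_apply]

lemma paleySeidel_mul_entry {a b : F} (h : a ≠ b) :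
    paleySeidel F a b * paleySeidel F a b = 1 := by
  rw [paleySeidel_apply, ← Int.cast_mul, quadraticChar_mul_self (sub_ne_zero.2 h), Int.cast_one]

/-- This coordinate-free form shows how the matrix behaves under linear maps: the determinant of a
pair is multiplied by the determinant of the map. The border sign of C is χ(-1). -/
lemma paleyConference_apply (hF : Odd (Fintype.card F)) (a b : Unit ⊕ F) :
    paleyConference F a b =
      ((quadraticChar F (pairDet (projectiveRep a) (projectiveRep b)) : ℤ) : ℂ) := by
  rcases a with a | a <;> rcases b with b | b
  · simp [paleyConference, pairDet, projectiveRep]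
  · simp [paleyConference, pairDet, projectiveRep]
  · simp only [paleyConference, pairDet, projectiveRep, Matrix.fromBlocks_apply₂₁, Matrix.of_apply,
      Sum.elim_inl, Sum.elim_inr, mul_zero, zero_sub, mul_one, quadraticChar_neg_one_eq hF]
    split_ifs <;> simp
  · simp [paleyConference, pairDet, projectiveRep, paleySeidel_apply]

lemma paleyConference_mul_self (hF : Odd (Fintype.card F)) :
    paleyConference F * paleyConference F = (negOneSign F * Fintype.card F) • 1 := by
  have hs : (Matrix.of fun _ _ => if Fintype.card F % 4 = 1 then 1 else -1 : Matrix F Unit ℂ) =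
      negOneSign F • Matrix.of fun _ _ => 1 := by
    ext a b
    simp only [negOneSign, quadraticChar_neg_one_eq hF, Matrix.smul_apply, Matrix.of_apply]
    split_ifs <;> simp
  rw [paleyConference, Matrix.fromBlocks_multiply, ← Matrix.fromBlocks_one, Matrix.fromBlocks_smul,
    hs, Matrix.mul_smul, Matrix.mul_smul, paleySeidel_mul_ones hF, ones_mul_paleySeidel hF,
    paleySeidel_mul_self hF]
  congr 1
  · ext a b; simp [Matrix.mul_apply]
  · simp
  · simp
  · ext a b
    simp only [Matrix.smul_mul, Matrix.add_apply, Matrix.smul_apply, Matrix.mul_apply,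
      Matrix.of_apply, Matrix.sub_apply, smul_eq_mul]
    simp
    ring

/-- The scalar `±1` or `±i` relating the Paley conference matrix to its signature matrix. -/
noncomputable def paleyScalar (F : Type*) [Fintype F] (δ : ℤˣ) : ℂ :=
  ((δ : ℤ) : ℂ) * (if Fintype.card F % 4 = 1 then 1 else Complex.I)

/-- With C² = χ(-1)qI and Cᵀ = χ(-1)C, a scalar ω with ω² = χ(-1) and ω̄ = χ(-1)ω makes ωC Hermitian
with square qI, uniformly in q mod 4. -/
lemma paleyScalar_mul_self (hF : Odd (Fintype.card F)) (δ : ℤˣ) :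
    paleyScalar F δ * paleyScalar F δ = negOneSign F := by
  have h := units_int_cast_mul_self δ
  rw [paleyScalar, negOneSign, quadraticChar_neg_one_eq hF]
  split_ifs
  · simpa using h
  · push_cast
    linear_combination Complex.I * Complex.I * h + Complex.I_mul_I

lemma star_paleyScalar (hF : Odd (Fintype.card F)) (δ : ℤˣ) :
    star (paleyScalar F δ) = negOneSign F * paleyScalar F δ := by
  rw [paleyScalar, negOneSign, quadraticChar_neg_one_eq hF]
  split_ifs <;> simp

lemma paleySignature_apply (hF : Odd (Fintype.card F)) (δ : ℤˣ) (a b : Unit ⊕ F) :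
    paleySignature F δ a b = paleyScalar F δ *
      ((quadraticChar F (pairDet (projectiveRep a) (projectiveRep b)) : ℤ) : ℂ) := by
  rw [← paleyConference_apply hF]; rfl

lemma paleySignature_mul_self (hF : Odd (Fintype.card F)) (δ : ℤˣ) :
    paleySignature F δ * paleySignature F δ = (Fintype.card F : ℂ) • 1 := by
  change (paleyScalar F δ • paleyConference F) * (paleyScalar F δ • paleyConference F) = _
  rw [Matrix.smul_mul, Matrix.mul_smul, smul_smul, paleyScalar_mul_self hF,
    paleyConference_mul_self hF, smul_smul, ← mul_assoc, negOneSign_mul_self, one_mul]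

lemma paleySignature_conjTranspose (hF : Odd (Fintype.card F)) (δ : ℤˣ) :
    (paleySignature F δ)ᴴ = paleySignature F δ := by
  ext a b
  rw [Matrix.conjTranspose_apply, paleySignature_apply hF, paleySignature_apply hF, star_mul',
    star_paleyScalar hF, pairDet_swap, quadraticChar_neg, RCLike.star_def, map_intCast,
    Int.cast_mul, ← negOneSign]
  linear_combination (paleyScalar F δ *
      ((quadraticChar F (pairDet (projectiveRep a) (projectiveRep b)) : ℤ) : ℂ)) *
      (negOneSign_mul_self (F := F))

lemma paleySignature_diag (hF : Odd (Fintype.card F)) (δ : ℤˣ) (a : Unit ⊕ F) :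
    paleySignature F δ a a = 0 := by
  rw [paleySignature_apply hF, pairDet_projectiveRep_eq_zero.2 rfl]; simp

lemma norm_paleySignature (hF : Odd (Fintype.card F)) (δ : ℤˣ) (a b : Unit ⊕ F) (hab : a ≠ b) :
    ‖paleySignature F δ a b‖ = 1 := by
  refine norm_eq_one_of_mul_star ?_
  rw [paleySignature_apply hF, star_mul', star_paleyScalar hF, RCLike.star_def,
    map_intCast]
  have h : ((quadraticChar F (pairDet (projectiveRep a) (projectiveRep b)) : ℤ) : ℂ) *
      ((quadraticChar F (pairDet (projectiveRep a) (projectiveRep b)) : ℤ) : ℂ) = 1 := by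
    rw [← Int.cast_mul, quadraticChar_mul_self (mt pairDet_projectiveRep_eq_zero.1 hab),
      Int.cast_one]
  linear_combination (negOneSign F * (paleyScalar F δ * paleyScalar F δ)) * h +
    negOneSign F * paleyScalar_mul_self hF δ + negOneSign_mul_self (F := F)

end Paley

/-! ### Doubles of G_q over prime fields -/

section Prime

/-- Matrices developed over the additive group of F become circulant because this group is cyclic;
primality of the order enters here. -/
lemma exists_equiv_fin_of_prime_card {F : Type*} [Field F] [Fintype F]
    (hp : (Fintype.card F).Prime) :
    ∃ σ : Fin (Fintype.card F) ≃ F, ∀ i j, σ (i - j) = σ i - σ j := by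
  obtain ⟨m, hm⟩ : ∃ m, Fintype.card F = m + 1 := ⟨Fintype.card F - 1, by have := hp.pos; omega⟩
  rw [hm] at hp ⊢
  have : Fact (m + 1).Prime := ⟨hp⟩
  exact ⟨(ZMod.ringEquivOfPrime F hp hm).toEquiv,
    fun i j => map_sub (ZMod.ringEquivOfPrime F hp hm) i j⟩

/-- Criterion for signature matrices that consist of blocks developed over the additive group of
a prime field. -/
lemma switchesToTwoCirculantETF_of_prime_card {F : Type*} [Field F] [Fintype F] [DecidableEq F]
    (hp : (Fintype.card F).Prime) {S : Matrix (F ⊕ F) (F ⊕ F) ℂ}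
    (hdiag : ∀ j, S j j = 0) (huni : ∀ j k, j ≠ k → ‖S j k‖ = 1) (hH : Sᴴ = S)
    (hS : S * S = (2 * Fintype.card F - 1 : ℂ) • (1 : Matrix (F ⊕ F) (F ⊕ F) ℂ)) (x y : F → ℂ)
    (h11 : ∀ a b, S (.inl a) (.inl b) = x (a - b)) (h12 : ∀ a b, S (.inl a) (.inr b) = y (a - b))
    (h22 : ∀ a b, S (.inr a) (.inr b) = -x (a - b)) :
    SwitchesToTwoCirculantETF (Fintype.card F) S := by
  obtain ⟨σ, hσ⟩ := exists_equiv_fin_of_prime_card hp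
  refine switchesToTwoCirculantETF_of_circulant_blocks hp.pos hdiag huni hH hS
    (Equiv.sumCongr σ σ) (fun _ => 1) (by simp) (fun i => x (σ i)) (fun i => y (σ i)) ?_ ?_ ?_ <;>
  · intro i j
    simp [hσ, h11, h12, h22]

/-- The all-ones matrix indexed by `F`. -/
def onesMatrix (F : Type*) : Matrix F F ℂ := Matrix.of fun _ _ => 1

lemma onesMatrix_mul_self {F : Type*} [Fintype F] : onesMatrix F * onesMatrix F = (Fintype.card F : ℂ) • onesMatrix F := by
  ext a b
  simp [onesMatrix, Matrix.mul_apply]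

lemma onesMatrix_conjTranspose {F : Type*} : (onesMatrix F)ᴴ = onesMatrix F := by
  ext a b
  simp [onesMatrix]

variable {F : Type*} [Field F] [Fintype F] [DecidableEq F]

lemma paleySeidel_conjTranspose : (paleySeidel F)ᴴ = negOneSign F • paleySeidel F := by
  ext a b
  rw [Matrix.conjTranspose_apply, star_paleySeidel, paleySeidel_swap, Matrix.smul_apply,
    smul_eq_mul]

lemma paleyAdjMatrix_eq : paleyAdjMatrix F =
    (2⁻¹ : ℂ) • (onesMatrix F - 1 + paleySeidel F) := by
  ext a b
  simp only [paleyAdjMatrix, onesMatrix, paleySeidel, Matrix.of_apply, Matrix.smul_apply,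
    Matrix.add_apply, Matrix.sub_apply, Matrix.one_apply, PaleyAdj, sub_ne_zero]
  by_cases h : a = b
  · simp [h]
  · by_cases h2 : IsSquare (a - b) <;> simp [h, h2]
    norm_num

/-- This quadratic equation for x is exactly the condition for the double to square to a scalar
matrix. The bound x² ≤ 1 makes √(1 - x²) the genuine imaginary part of a unimodular β. -/
lemma graphDoublingX_spec {v : ℕ} (hv : 2 ≤ v) :
    ((v : ℝ) - 1) * graphDoublingX v ^ 2 + 2 * graphDoublingX v - 2 = 0 ∧
      graphDoublingX v ^ 2 ≤ 1 := by
  have hv' : (2 : ℝ) ≤ v := by exact_mod_cast hv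
  have h0 : (0 : ℝ) < v - 1 := by linarith
  set s := √(2 * (v : ℝ) - 1) with hs
  have hs2 : s ^ 2 = 2 * v - 1 := Real.sq_sqrt (by linarith)
  have hs1 : 1 ≤ s := Real.one_le_sqrt.2 (by linarith)
  have hsv : s ≤ v := Real.sqrt_le_iff.2 ⟨by linarith, by nlinarith⟩
  have hx : graphDoublingX v * (v - 1) = -1 + s := by
    rw [graphDoublingX, div_mul_cancel₀ _ h0.ne']
  have hx0 : 0 ≤ graphDoublingX v := div_nonneg (by linarith) h0.le
  have hx1 : graphDoublingX v ≤ 1 := (div_le_one h0).2 (by linarith)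
  refine ⟨?_, by nlinarith⟩
  -- After multiplication by v-1 the equation is ((v-1)x + 1)² = 2v-1.
  refine (mul_eq_zero.1 (?_ : ((v : ℝ) - 1) * _ = 0)).resolve_left h0.ne'
  linear_combination (graphDoublingX v * (v - 1) + 1 + s) * hx + hs2

/-- The matrix `e(1-x)I + exJ + sT`, which for `s = iy` is the off-diagonal block of a doubled
conference graph. -/
noncomputable def graphBlock (F : Type*) [Field F] [DecidableEq F] (e x s : ℂ) : Matrix F F ℂ :=
  (e * (1 - x)) • 1 + (e * x) • onesMatrix F + s • paleySeidel F

/-- As A and B are (J - I ± T)/2, the sum βA + β̄B is Re β·(J - I) + i Im β·T. In terms of I, J and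
T products are easy to compute. -/
lemma doubleGraphSignature_eq (ε : ℤˣ) : doubleGraphSignature ε (paleyAdjMatrix F) =
    Matrix.fromBlocks (paleySeidel F)
      (graphBlock F ((ε : ℤ) : ℂ) (graphDoublingX (Fintype.card F))
        (Complex.I * (√(1 - graphDoublingX (Fintype.card F) ^ 2) : ℝ)))
      (graphBlock F ((ε : ℤ) : ℂ) (graphDoublingX (Fintype.card F))
        (-(Complex.I * (√(1 - graphDoublingX (Fintype.card F) ^ 2) : ℝ)))) (-paleySeidel F) := by
  have hB : (Matrix.of fun _ _ => 1) - 1 - paleyAdjMatrix F =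
      (2⁻¹ : ℂ) • (onesMatrix F - 1 - paleySeidel F) := by
    rw [paleyAdjMatrix_eq]
    change onesMatrix F - 1 - _ = _
    module
  have hβ : star (graphDoublingBeta (Fintype.card F) ε) = ((ε : ℤ) : ℂ) *
      graphDoublingX (Fintype.card F) -
      Complex.I * (√(1 - graphDoublingX (Fintype.card F) ^ 2) : ℝ) := by
    simp [graphDoublingBeta, ← sub_eq_add_neg]
  simp only [doubleGraphSignature, hB, hβ, graphBlock]
  rw [paleyAdjMatrix_eq, graphDoublingBeta]
  congr 1 <;> module

theorem switchesToTwoCirculantETF_doubled_paley_graph (hp : (Fintype.card F).Prime)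
    (h4 : Fintype.card F % 4 = 1) (ε : ℤˣ) :
    SwitchesToTwoCirculantETF (Fintype.card F) (doubleGraphSignature ε (paleyAdjMatrix F)) := by
  have hodd : Odd (Fintype.card F) := Nat.odd_iff.2 (by omega)
  have hs1 : negOneSign F = 1 := by rw [negOneSign, quadraticChar_neg_one_eq hodd, if_pos h4]; simp
  obtain ⟨hx, hx1⟩ := graphDoublingX_spec hp.two_le
  rw [doubleGraphSignature_eq]
  set x := graphDoublingX (Fintype.card F)
  have hxC : ((Fintype.card F : ℂ) - 1) * (x : ℂ) ^ 2 + 2 * x - 2 = 0 := by exact_mod_cast hx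
  set e : ℂ := ((ε : ℤ) : ℂ) with he
  have he2 : e * e = 1 := units_int_cast_mul_self ε
  have hes : star e = e := by simp [he]
  set s : ℂ := Complex.I * (√(1 - x ^ 2) : ℝ) with hs
  have hs2 : s * s = x ^ 2 - 1 := by
    have h : ((√(1 - x ^ 2) : ℝ) : ℂ) * (√(1 - x ^ 2) : ℝ) = 1 - (x : ℂ) ^ 2 := by
      rw [← Complex.ofReal_mul, Real.mul_self_sqrt (by linarith)]; simp
    rw [hs]
    linear_combination Complex.I * Complex.I * h + (1 - (x : ℂ) ^ 2) * Complex.I_mul_I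
  have hss : star s = -s := by simp [hs]
  have hT2 : paleySeidel F * paleySeidel F = (Fintype.card F : ℂ) • 1 - onesMatrix F := by
    rw [paleySeidel_mul_self hodd, hs1, one_smul]; rfl
  have hTJ : paleySeidel F * onesMatrix F = 0 := paleySeidel_mul_ones hodd
  have hJT : onesMatrix F * paleySeidel F = 0 := ones_mul_paleySeidel hodd
  have hTH : (paleySeidel F)ᴴ = paleySeidel F := by rw [paleySeidel_conjTranspose, hs1, one_smul]
  have hY : ∀ t : ℂ, (graphBlock F e x t)ᴴ = graphBlock F e x (star t) := fun t => by
    simp [graphBlock, Matrix.conjTranspose_add, Matrix.conjTranspose_smul, hTH,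
      onesMatrix_conjTranspose, he]
  have hYapp : ∀ t a b, a ≠ b → graphBlock F e x t a b = e * x + t * paleySeidel F a b :=
    fun t a b hab => by
      simp [graphBlock, onesMatrix, Matrix.one_apply_ne hab]
  have hYdiag : ∀ t a, graphBlock F e x t a a = e := fun t a => by
    simp [graphBlock, onesMatrix, paleySeidel_diag]; ring
  have hprod : ∀ t : ℂ, t * t = x ^ 2 - 1 → graphBlock F e x t * graphBlock F e x (-t) +
      paleySeidel F * paleySeidel F = (2 * Fintype.card F - 1 : ℂ) • 1 := fun t ht => by
    have : graphBlock F e x t * graphBlock F e x (-t) + paleySeidel F * paleySeidel F =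
        (e * e * (1 - x) ^ 2 - t * t * Fintype.card F + Fintype.card F) • 1 +
        (e * e * (2 * x * (1 - x) + x ^ 2 * Fintype.card F) + t * t - 1) • onesMatrix F := by
      simp only [graphBlock, add_mul, mul_add, Matrix.smul_mul, Matrix.mul_smul, Matrix.mul_one,
        Matrix.one_mul, hT2, hTJ, hJT, onesMatrix_mul_self]
      module
    rw [this, ht, he2]
    -- The correct coefficient of I and the vanishing of the coefficient of J are both equivalent to
    -- the single quadratic equation for x.
    have h1 : (1 * (1 - (x : ℂ)) ^ 2 - (x ^ 2 - 1) * Fintype.card F + Fintype.card F) =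
        2 * Fintype.card F - 1 := by linear_combination -hxC
    have h2 : (1 * (2 * x * (1 - x) + (x : ℂ) ^ 2 * Fintype.card F) + (x ^ 2 - 1) - 1) = 0 := by
      linear_combination hxC
    rw [h1, h2, zero_smul, add_zero]
  have hcomm : ∀ t : ℂ, graphBlock F e x t * paleySeidel F = paleySeidel F * graphBlock F e x t :=
    fun t => by
      simp only [graphBlock, add_mul, mul_add, Matrix.smul_mul, Matrix.mul_smul, Matrix.mul_one,
        Matrix.one_mul, hTJ, hJT]
  have hnormY : ∀ (t : ℂ) a b, t * t = x ^ 2 - 1 → star t = -t → ‖graphBlock F e x t a b‖ = 1 := by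
    intro t a b ht hts
    refine norm_eq_one_of_mul_star ?_
    by_cases hab : a = b
    · rw [hab, hYdiag, hes, he2]
    · rw [hYapp t a b hab, star_add, star_mul', star_mul', hes, hts, star_paleySeidel,
        RCLike.star_def, Complex.conj_ofReal]
      linear_combination x ^ 2 * he2 - ht - t * t * paleySeidel_mul_entry hab
  have hnormT : ∀ a b : F, a ≠ b → ‖paleySeidel F a b‖ = 1 := fun a b hab =>
    norm_eq_one_of_mul_star (by rw [star_paleySeidel, paleySeidel_mul_entry hab])
  refine switchesToTwoCirculantETF_of_prime_card hp ?_ ?_ ?_ ?_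
    (fun a => paleySeidel F a 0) (fun a => graphBlock F e x s a 0) ?_ ?_ ?_
  · rintro (a | a) <;> simp [paleySeidel_diag]
  · rintro (a | a) (b | b) hab
    · exact hnormT a b (by simpa using hab)
    · exact hnormY _ _ _ hs2 hss
    · exact hnormY _ _ _ (by rw [neg_mul_neg, hs2]) (by rw [star_neg, hss])
    · rw [Matrix.fromBlocks_apply₂₂, Matrix.neg_apply, norm_neg]
      exact hnormT a b (by simpa using hab)
  · rw [Matrix.fromBlocks_conjTranspose, hY, hY, star_neg, hss, neg_neg,
      Matrix.conjTranspose_neg, hTH]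
  · rw [Matrix.fromBlocks_multiply, ← Matrix.fromBlocks_one, Matrix.fromBlocks_smul]
    congr 1
    · rw [add_comm, hprod s hs2]
    · rw [mul_neg, hcomm, smul_zero, add_neg_cancel]
    · rw [neg_mul, hcomm, smul_zero, add_neg_cancel]
    · rw [neg_mul_neg, ← hprod (-s) (by rw [neg_mul_neg, hs2]), neg_neg]
  · intro a b
    simp [paleySeidel_apply]
  · intro a b
    simp [graphBlock, onesMatrix, paleySeidel_apply, Matrix.one_apply, sub_eq_zero]
  · intro a b
    simp [paleySeidel_apply]

/-- With r² = q and w² = q+1 the normalizing factor is r/w². The coefficient of I becomes wr²/w² - w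
= -1/w, which cancels the diagonal of J/w. -/
lemma renesStrohmerSignature_eq : renesStrohmerSignature F =
    ((√((Fintype.card F : ℝ) + 1) : ℝ) : ℂ)⁻¹ •
      ((Complex.I * (√(Fintype.card F : ℝ) : ℝ)) • paleySeidel F + onesMatrix F - 1) := by
  have hq : (0 : ℝ) < Fintype.card F := by exact_mod_cast Fintype.card_pos
  have hr2 : ((√(Fintype.card F : ℝ) : ℝ) : ℂ) * (√(Fintype.card F : ℝ) : ℝ) = Fintype.card F := by
    rw [← Complex.ofReal_mul, Real.mul_self_sqrt hq.le]; simp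
  have hw2 : ((√((Fintype.card F : ℝ) + 1) : ℝ) : ℂ) * (√((Fintype.card F : ℝ) + 1) : ℝ) =
      Fintype.card F + 1 := by
    rw [← Complex.ofReal_mul, Real.mul_self_sqrt (by linarith)]; simp
  have hr0 : ((√(Fintype.card F : ℝ) : ℝ) : ℂ) ≠ 0 := by
    exact_mod_cast (Real.sqrt_pos.2 hq).ne'
  have hw0 : ((√((Fintype.card F : ℝ) + 1) : ℝ) : ℂ) ≠ 0 := by
    exact_mod_cast (Real.sqrt_pos.2 (by linarith : (0 : ℝ) < Fintype.card F + 1)).ne'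
  have hinv : (((1 / √(Fintype.card F : ℝ) + √(Fintype.card F : ℝ) : ℝ)) : ℂ)⁻¹ =
      (√(Fintype.card F : ℝ) : ℝ) * ((Fintype.card F : ℂ) + 1)⁻¹ := by
    have : (((1 / √(Fintype.card F : ℝ) + √(Fintype.card F : ℝ) : ℝ)) : ℂ) =
        ((Fintype.card F : ℂ) + 1) * ((√(Fintype.card F : ℝ) : ℝ) : ℂ)⁻¹ := by
      push_cast
      field_simp
      linear_combination hr2
    rw [this, mul_inv, inv_inv, mul_comm]
  have hJ : (Matrix.of fun _ _ => 1 : Matrix F F ℂ) = onesMatrix F := rfl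
  simp only [renesStrohmerSignature, renesStrohmerGram, hinv, hJ]
  rw [← hw2]
  push_cast
  generalize ((√(Fintype.card F : ℝ) : ℝ) : ℂ) = r at *
  generalize ((√((Fintype.card F : ℝ) + 1) : ℝ) : ℂ) = w at *
  have hrw : r * r = w * w - 1 := by rw [hr2, hw2]; ring
  rw [smul_sub, smul_smul, smul_add, smul_add, smul_sub, smul_add, smul_smul, smul_smul, smul_smul,
    smul_smul, add_sub_assoc, add_sub_assoc, add_assoc]
  have h1 : w * (r * (w * w)⁻¹) * Complex.I = w⁻¹ * (Complex.I * r) := by field_simp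
  have h2 : w * (r * (w * w)⁻¹) * (1 / r) = w⁻¹ := by field_simp
  have h3 : w * (r * (w * w)⁻¹) * r = w - w⁻¹ := by
    field_simp
    linear_combination hrw
  rw [h1, h2, h3]
  module

/-- The sign η treats the frame and its Naimark complement together. As T is skew with T² = J - qI,
the matrix M = i√q T + J - I is Hermitian and satisfies M² = (q²-1)I - 2M. Dividing by q+1 gives R²
= (q-1)I + cR for R = ηM/√(q+1), as doubling requires. -/
theorem switchesToTwoCirculantETF_doubled_renesStrohmer (hp : (Fintype.card F).Prime)
    (h4 : Fintype.card F % 4 = 3) (ε η : ℤˣ) {d : ℕ}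
    (hd : 2 * (d : ℤ) = Fintype.card F + η) :
    SwitchesToTwoCirculantETF (Fintype.card F)
      (doubleSignature d ε (((η : ℤ) : ℂ) • renesStrohmerSignature F)) := by
  have hodd : Odd (Fintype.card F) := Nat.odd_iff.2 (by omega)
  have hs1 : negOneSign F = -1 := by
    rw [negOneSign, quadraticChar_neg_one_eq hodd, if_neg (by omega)]; simp
  have hq3 : (3 : ℝ) ≤ Fintype.card F := by
    exact_mod_cast (by omega : 3 ≤ Fintype.card F)
  have hη2 : ((η : ℤ) : ℂ) * ((η : ℤ) : ℂ) = 1 := units_int_cast_mul_self η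
  have hηR : ((η : ℤ) : ℝ) * ((η : ℤ) : ℝ) = 1 := by exact_mod_cast hη2
  have hw : 0 < √((Fintype.card F : ℝ) + 1) := Real.sqrt_pos.2 (by linarith)
  have hwsq : √((Fintype.card F : ℝ) + 1) * √((Fintype.card F : ℝ) + 1) = Fintype.card F + 1 :=
    Real.mul_self_sqrt (by linarith)
  -- Here n - 2d = -η and 4d(n-d) = q² - 1.
  have hc : doublingConst d (Fintype.card F) =
      -2 * ((η : ℤ) : ℝ) * (√((Fintype.card F : ℝ) + 1))⁻¹ := by
    have hdR : 2 * (d : ℝ) = Fintype.card F + ((η : ℤ) : ℝ) := by exact_mod_cast hd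
    have h1 : (d : ℝ) * (Fintype.card F - d) = (Fintype.card F - 1) * (Fintype.card F + 1) / 4 := by
      rw [show (d : ℝ) = (Fintype.card F + ((η : ℤ) : ℝ)) / 2 by linarith]
      linear_combination -(1 / 4) * hηR
    rw [doublingConst, h1, hdR]
    have h2 : ((Fintype.card F : ℝ) - 1) / ((Fintype.card F - 1) * (Fintype.card F + 1) / 4) =
        (2 * (√((Fintype.card F : ℝ) + 1))⁻¹) ^ 2 := by
      have h3 : (Fintype.card F : ℝ) - 1 ≠ 0 := by linarith
      rw [mul_pow, inv_pow, sq (√_), hwsq]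
      have h4 : (Fintype.card F : ℝ) + 1 ≠ 0 := by linarith
      field_simp
      norm_num
    rw [h2, Real.sqrt_sq (by positivity)]
    ring
  -- The square is 4/(q+1), so the bound is precisely q ≥ 3.
  have hc1 : doublingConst d (Fintype.card F) ^ 2 ≤ 1 := by
    have : doublingConst d (Fintype.card F) ^ 2 = 4 / (Fintype.card F + 1) := by
      have h1 : (√((Fintype.card F : ℝ) + 1))⁻¹ * √((Fintype.card F : ℝ) + 1) = 1 :=
        inv_mul_cancel₀ hw.ne'
      rw [hc, eq_div_iff (by linarith), ← hwsq]
      have : ∀ w η : ℝ, w⁻¹ * w = 1 → η * η = 1 → (-2 * η * w⁻¹) ^ 2 * (w * w) = 4 :=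
        fun w η h h' => by
          linear_combination 4 * (w⁻¹ * w) ^ 2 * h' + 4 * (w⁻¹ * w + 1) * h
      rw [hwsq, eq_comm, ← this _ _ h1 hηR, hwsq]
    rw [this, div_le_one (by linarith)]
    linarith
  have hr2 : ((√(Fintype.card F : ℝ) : ℝ) : ℂ) * (√(Fintype.card F : ℝ) : ℝ) = Fintype.card F := by
    rw [← Complex.ofReal_mul, Real.mul_self_sqrt (by linarith)]; simp
  have hw2 : ((√((Fintype.card F : ℝ) + 1) : ℝ) : ℂ)⁻¹ * ((√((Fintype.card F : ℝ) + 1) : ℝ) : ℂ)⁻¹ *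
      (Fintype.card F + 1) = 1 := by
    rw [← mul_inv, ← Complex.ofReal_mul, hwsq]
    have : (Fintype.card F + 1 : ℂ) ≠ 0 := Nat.cast_add_one_ne_zero _
    push_cast
    exact inv_mul_cancel₀ this
  have hcC : (doublingConst d (Fintype.card F) : ℂ) =
      -2 * ((η : ℤ) : ℂ) * ((√((Fintype.card F : ℝ) + 1) : ℝ) : ℂ)⁻¹ := by
    rw [hc]; push_cast; rfl
  have hws : star (((√((Fintype.card F : ℝ) + 1) : ℝ) : ℂ)⁻¹) =
      ((√((Fintype.card F : ℝ) + 1) : ℝ) : ℂ)⁻¹ := by simp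
  have hrs : star (Complex.I * ((√(Fintype.card F : ℝ) : ℝ) : ℂ)) =
      -(Complex.I * ((√(Fintype.card F : ℝ) : ℝ) : ℂ)) := by simp
  have hr2' : (Complex.I * ((√(Fintype.card F : ℝ) : ℝ) : ℂ)) *
      (Complex.I * ((√(Fintype.card F : ℝ) : ℝ) : ℂ)) = -Fintype.card F := by
    linear_combination Complex.I * Complex.I * hr2 + (Fintype.card F : ℂ) * Complex.I_mul_I
  have hηs : star ((η : ℤ) : ℂ) = ((η : ℤ) : ℂ) := by simp
  have hT2 : paleySeidel F * paleySeidel F = onesMatrix F - (Fintype.card F : ℂ) • 1 := by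
    rw [paleySeidel_mul_self hodd, hs1, neg_one_smul, neg_sub]; rfl
  have hTJ : paleySeidel F * onesMatrix F = 0 := paleySeidel_mul_ones hodd
  have hJT : onesMatrix F * paleySeidel F = 0 := ones_mul_paleySeidel hodd
  have hTH : (paleySeidel F)ᴴ = -paleySeidel F := by
    rw [paleySeidel_conjTranspose, hs1, neg_one_smul]
  rw [renesStrohmerSignature_eq]
  generalize hw' : ((√((Fintype.card F : ℝ) + 1) : ℝ) : ℂ)⁻¹ = w at *
  generalize hr' : Complex.I * ((√(Fintype.card F : ℝ) : ℝ) : ℂ) = r at *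
  generalize ((η : ℤ) : ℂ) = η' at *
  set R : Matrix F F ℂ := η' • w • (r • paleySeidel F + onesMatrix F - 1) with hR
  have hRdiag : ∀ a, R a a = 0 := fun a => by simp [hR, paleySeidel_diag, onesMatrix]
  have hRapp : ∀ a b, a ≠ b → R a b = η' * (w * (r * paleySeidel F a b + 1)) :=
    fun a b hab => by simp [hR, onesMatrix, Matrix.one_apply_ne hab]
  have hRuni : ∀ a b, a ≠ b → ‖R a b‖ = 1 := fun a b hab => by
    refine norm_eq_one_of_mul_star ?_
    rw [hRapp a b hab, star_mul', star_mul', star_add, star_mul', hηs, hws, hrs, star_paleySeidel,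
      star_one]
    linear_combination (w * w * (1 - r * r * (paleySeidel F a b * paleySeidel F a b))) * hη2 +
      hw2 - w * w * (paleySeidel F a b * paleySeidel F a b) * hr2' +
      w * w * (Fintype.card F : ℂ) * paleySeidel_mul_entry hab
  have hRH : Rᴴ = R := by
    rw [hR, Matrix.conjTranspose_smul, Matrix.conjTranspose_smul, Matrix.conjTranspose_sub,
      Matrix.conjTranspose_add, Matrix.conjTranspose_smul, hTH, hηs, hws, hrs,
      onesMatrix_conjTranspose, Matrix.conjTranspose_one, smul_neg, neg_smul, neg_neg]
  have hRR : R * R = (Fintype.card F - 1 : ℂ) • (1 : Matrix F F ℂ) +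
      (doublingConst d (Fintype.card F) : ℂ) • R := by
    have h1 : R * R = ((η' * η') * (w * w)) • ((r * r) • (paleySeidel F * paleySeidel F) +
        ((Fintype.card F : ℂ) - 2) • onesMatrix F + (1 : ℂ) • 1 - (2 * r) • paleySeidel F) := by
      simp only [hR, add_mul, mul_add, sub_mul, mul_sub, Matrix.smul_mul, Matrix.mul_smul,
        Matrix.mul_one, Matrix.one_mul, hTJ, hJT, onesMatrix_mul_self]
      module
    have h2 : (doublingConst d (Fintype.card F) : ℂ) • R = ((η' * η') * (w * w)) •
        ((-2 * r) • paleySeidel F + (-2 : ℂ) • onesMatrix F + (2 : ℂ) • 1) := by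
      rw [hcC, hR]
      module
    have h3 : (Fintype.card F - 1 : ℂ) • (1 : Matrix F F ℂ) =
        (w * w) • ((Fintype.card F + 1) * (Fintype.card F - 1) : ℂ) • 1 := by
      rw [smul_smul, ← mul_assoc, hw2, one_mul]
    rw [h1, h2, h3, hη2, one_mul, hr2', hT2]
    module
  refine switchesToTwoCirculantETF_of_prime_card hp (doubleSignature_diag ε hRdiag)
    (norm_doubleSignature ε hc1 hRdiag hRuni) (doubleSignature_conjTranspose ε hRH)
    (doubleSignature_mul_self ε hc1 hRR) (fun a => R a 0)
    (fun a => (R + doublingBeta d (Fintype.card F) ε • (1 : Matrix F F ℂ)) a 0) ?_ ?_ ?_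
  · intro a b
    simp [doubleSignature, hR, onesMatrix, paleySeidel_apply, Matrix.one_apply, sub_eq_zero]
  · intro a b
    simp [doubleSignature, hR, onesMatrix, paleySeidel_apply, Matrix.one_apply, sub_eq_zero]
  · intro a b
    simp [doubleSignature, hR, onesMatrix, paleySeidel_apply, Matrix.one_apply, sub_eq_zero]

end Prime

/-! ### The Singer cycle on the projective line -/

section Singer

variable {F : Type*} [Field F] [Fintype F] [DecidableEq F]

lemma pairDet_smul_smul {F : Type*} [Field F] (a b : F) (x y : F × F) :
    pairDet (a • x) (b • y) = a * b * pairDet x y := by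
  simp only [pairDet, Prod.smul_fst, Prod.smul_snd, smul_eq_mul]; ring

lemma exists_smul_projectiveRep {F : Type*} [Field F] {v : F × F} (hv : v ≠ 0) :
    ∃ (a : Unit ⊕ F) (s : F), s ≠ 0 ∧ v = s • projectiveRep a := by
  obtain ⟨x, y⟩ := v
  by_cases hy : y = 0
  · subst hy
    exact ⟨.inl (), x, fun h => hv (by simp [h]), by simp [projectiveRep]⟩
  · exact ⟨.inr (x / y), y, hy, by simp [projectiveRep, mul_div_cancel₀ _ hy]⟩

/-- Multiplication by z is an F-linear map of the plane whose determinant is the norm of z. -/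
lemma QuadraticAlgebra.pairDet_mul {F : Type*} [Field F] {a b : F} (z x y : QuadraticAlgebra F a b) :
    pairDet ((z * x).re, (z * x).im) ((z * y).re, (z * y).im) =
      QuadraticAlgebra.norm z * pairDet (x.re, x.im) (y.re, y.im) := by
  simp only [pairDet, QuadraticAlgebra.re_mul, QuadraticAlgebra.im_mul, QuadraticAlgebra.norm_def]
  ring

lemma QuadraticAlgebra.exists_smul_of_pairDet_eq_zero {F : Type*} [Field F] {a b : F}
    {x y : QuadraticAlgebra F a b} (h : pairDet (x.re, x.im) (y.re, y.im) = 0) (hy : y ≠ 0) :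
    ∃ c : F, x = c • y := by
  simp only [pairDet] at h
  by_cases h0 : y.im = 0
  · have h1 : y.re ≠ 0 := fun h1 => hy (QuadraticAlgebra.ext h1 h0)
    rw [h0, mul_zero, zero_sub, neg_eq_zero, mul_eq_zero, or_iff_left h1] at h
    refine ⟨x.re / y.re, QuadraticAlgebra.ext ?_ ?_⟩
    · simp [div_mul_cancel₀ _ h1]
    · simp [h0, h]
  · refine ⟨x.im / y.im, QuadraticAlgebra.ext ?_ ?_⟩
    · simp only [QuadraticAlgebra.re_smul, smul_eq_mul]
      field_simp
      linear_combination h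
    · simp [div_mul_cancel₀ _ h0]

lemma QuadraticAlgebra.algebraNorm_eq_norm {F : Type*} [Field F] {a b : F}
    (z : QuadraticAlgebra F a b) : Algebra.norm F z = QuadraticAlgebra.norm z := by
  rw [← QuadraticAlgebra.det_toLinearMap_eq_norm, Algebra.norm_apply]
  rfl

/-- A Singer cycle: the powers of a primitive element of the quadratic extension of `F`, in
coordinates. -/
lemma exists_singer_cycle (hF : Odd (Fintype.card F)) :
    ∃ (w : ℤ → F × F) (N : F), quadraticChar F N = -1 ∧
      (∀ (i : ℤ) (j : ℕ), pairDet (w i) (w j) = N ^ j * pairDet (w (i - j)) (w 0)) ∧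
      (∀ m, w (m + (Fintype.card F + 1)) = N • w m) ∧ (∀ m, w m ≠ 0) ∧
      (∀ i j : ℕ, i ≤ Fintype.card F → j ≤ Fintype.card F → pairDet (w i) (w j) = 0 → i = j) := by
  obtain ⟨a, ha⟩ := FiniteField.exists_nonsquare (ringChar_ne_two_of_odd_card hF)
  -- Since a is not a square, adjoining √a gives a field with q² elements.
  have : Fact (∀ r : F, r ^ 2 ≠ a + 0 * r) :=
    ⟨fun r hr => ha ⟨r, by rw [← sq, hr]; ring⟩⟩
  have hfin : Finite (QuadraticAlgebra F a 0) := Finite.of_equiv _ (QuadraticAlgebra.equivProd a 0).symm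
  set q := Fintype.card F with hq
  have hq1 : 1 < q := Fintype.one_lt_card
  have hcardK : Nat.card (QuadraticAlgebra F a 0) = q ^ 2 := by
    rw [Nat.card_congr (QuadraticAlgebra.equivProd a 0), Nat.card_prod, Nat.card_eq_fintype_card, sq]
  have hfac : q ^ 2 - 1 = (q + 1) * (q - 1) := by rw [← Nat.sq_sub_sq, one_pow]
  obtain ⟨g, hg⟩ := IsCyclic.exists_monoid_generator (α := (QuadraticAlgebra F a 0)ˣ)
  have hord : orderOf g = (q + 1) * (q - 1) := by
    rw [orderOf_eq_card_of_forall_mem_powers hg, Nat.card_units, hcardK, hfac]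
  set N := QuadraticAlgebra.norm (g : QuadraticAlgebra F a 0) with hN
  -- The norm of g is the product of g and its conjugate g^q.
  have hpow : (g : QuadraticAlgebra F a 0) ^ (q + 1) = algebraMap F (QuadraticAlgebra F a 0) N := by
    rw [hN, ← QuadraticAlgebra.algebraNorm_eq_norm, FiniteField.algebraMap_norm_eq_pow, hcardK,
      Nat.card_eq_fintype_card, ← hq, hfac, Nat.mul_div_cancel _ (by omega)]
  -- If the norm of g were a square, so would be every norm of a power of g, that is, every nonzero
  -- norm. But the norm is surjective and attains the nonsquare a.
  have hχ : quadraticChar F N = -1 := by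
    rw [quadraticChar_neg_one_iff_not_isSquare]
    intro hsq
    obtain ⟨z, hz⟩ := FiniteField.norm_surjective F (QuadraticAlgebra F a 0) a
    rw [QuadraticAlgebra.algebraNorm_eq_norm] at hz
    have hz0 : z ≠ 0 := by
      rintro rfl
      rw [QuadraticAlgebra.norm_zero] at hz
      exact ha (hz ▸ ⟨0, by simp⟩)
    obtain ⟨k, hk⟩ := hg (Units.mk0 z hz0)
    have hk' : (g : QuadraticAlgebra F a 0) ^ k = z := by
      have := congrArg Units.val hk
      simpa using this
    rw [← hk', map_pow] at hz
    exact ha (hz ▸ hsq.pow k)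
  refine ⟨fun m => (((g ^ m : (QuadraticAlgebra F a 0)ˣ) : QuadraticAlgebra F a 0).re, ((g ^ m : (QuadraticAlgebra F a 0)ˣ) : QuadraticAlgebra F a 0).im), N, hχ, ?_, ?_, ?_, ?_⟩
  · intro i j
    have h1 : ((g ^ i : (QuadraticAlgebra F a 0)ˣ) : QuadraticAlgebra F a 0) = (g : QuadraticAlgebra F a 0) ^ j * ((g ^ (i - j) : (QuadraticAlgebra F a 0)ˣ) : QuadraticAlgebra F a 0) := by
      rw [← Units.val_pow_eq_pow_val, ← Units.val_mul, ← zpow_natCast, ← zpow_add,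
        add_sub_cancel]
    have h2 : ((g ^ (j : ℤ) : (QuadraticAlgebra F a 0)ˣ) : QuadraticAlgebra F a 0) = (g : QuadraticAlgebra F a 0) ^ j * ((g ^ (0 : ℤ) : (QuadraticAlgebra F a 0)ˣ) : QuadraticAlgebra F a 0) := by simp
    simp only [h1, h2, QuadraticAlgebra.pairDet_mul, map_pow]
    rfl
  · intro m
    have h1 : ((g ^ (m + ((q : ℤ) + 1)) : (QuadraticAlgebra F a 0)ˣ) : QuadraticAlgebra F a 0) = algebraMap F (QuadraticAlgebra F a 0) N * ((g ^ m : (QuadraticAlgebra F a 0)ˣ) : QuadraticAlgebra F a 0) := by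
      rw [← hpow, ← Units.val_pow_eq_pow_val, ← Units.val_mul, ← zpow_natCast, ← zpow_add,
        add_comm m]
      push_cast
      rfl
    simp only [h1, ← Algebra.smul_def]
    rfl
  · intro m h
    refine (g ^ m).ne_zero (QuadraticAlgebra.ext ?_ ?_)
    · exact congrArg Prod.fst h
    · exact congrArg Prod.snd h
  · intro i j hi hj h
    have hne := (g ^ j).ne_zero
    simp only [zpow_natCast, Units.val_pow_eq_pow_val] at h hne
    obtain ⟨c, hc⟩ := QuadraticAlgebra.exists_smul_of_pairDet_eq_zero h hne
    have hc0 : c ≠ 0 := by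
      rintro rfl
      rw [zero_smul] at hc
      exact pow_ne_zero _ g.ne_zero hc
    -- Raising to the power q-1 removes the factor c from F; the exponents are below the order
    -- (q+1)(q-1) of g, so they agree.
    have h1 : g ^ (i * (q - 1)) = g ^ (j * (q - 1)) := by
      refine Units.ext ?_
      rw [Units.val_pow_eq_pow_val, Units.val_pow_eq_pow_val, pow_mul, pow_mul, hc, smul_pow,
        FiniteField.pow_card_sub_one_eq_one c hc0, one_smul]
    have h2 := pow_inj_mod.1 h1
    have hlt : ∀ k ≤ q, k * (q - 1) < (q + 1) * (q - 1) := fun k hk =>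
      Nat.mul_lt_mul_of_pos_right (by omega) (by omega)
    rw [hord, Nat.mod_eq_of_lt (hlt i hi), Nat.mod_eq_of_lt (hlt j hj)] at h2
    exact Nat.eq_of_mul_eq_mul_right (by omega) h2

end Singer

/-! ### Negacyclic form, the Paley ETFs and their doubles -/

section Switching

variable {F : Type*} [Field F] [Fintype F] [DecidableEq F]

/-- In the order given by a Singer cycle the Paley conference matrix is switching equivalent to a
negacyclic matrix with alternating column signs. -/
lemma exists_singer_order (hF : Odd (Fintype.card F)) {n : ℕ} (hn : n = Fintype.card F + 1) :
    ∃ (e : Fin n ≃ Unit ⊕ F) (s : Fin n → ℂ) (h : ℤ → ℂ),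
      (∀ i, star (s i) * s i = 1) ∧ (∀ m, h (m + n) = -h m) ∧
      ∀ (δ : ℤˣ) i j, star (s i) * paleySignature F δ (e i) (e j) * s j =
        paleyScalar F δ * ((-1) ^ (j : ℕ) * h ((i : ℤ) - j)) := by
  subst hn
  obtain ⟨w, N, hN, hw, hper, hw0, hinj⟩ := exists_singer_cycle hF
  choose p t ht0 hpt using fun i : Fin (Fintype.card F + 1) => exists_smul_projectiveRep (hw0 i)
  have hp : Function.Injective p := fun i j hij => by
    have h1 : pairDet (w i) (w j) = 0 := by
      rw [hpt i, hpt j, pairDet_smul_smul, pairDet_projectiveRep_eq_zero.2 hij, mul_zero]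
    exact Fin.ext (hinj i j (by omega) (by omega) h1)
  have hpb : Function.Bijective p :=
    (Fintype.bijective_iff_injective_and_card p).2 ⟨hp, by simp [add_comm]⟩
  have hs : ∀ i, star ((quadraticChar F (t i) : ℤ) : ℂ) = ((quadraticChar F (t i) : ℤ) : ℂ) :=
    fun i => by rw [RCLike.star_def, map_intCast]
  have hss : ∀ i, ((quadraticChar F (t i) : ℤ) : ℂ) * ((quadraticChar F (t i) : ℤ) : ℂ) = 1 :=
    fun i => by rw [← Int.cast_mul, quadraticChar_mul_self (ht0 i), Int.cast_one]
  -- Passing from w(i) to the chosen representative of its point costs the sign χ(t i). Shifting by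
  -- q+1 multiplies h by χ(N) = -1, and moving j to 0 extracts χ(N)^j = (-1)^j.
  refine ⟨Equiv.ofBijective p hpb, fun i => ((quadraticChar F (t i) : ℤ) : ℂ),
    fun m => ((quadraticChar F (pairDet (w m) (w 0)) : ℤ) : ℂ), ?_, ?_, ?_⟩
  · intro i
    rw [hs, hss]
  · intro m
    have h1 := pairDet_smul_smul N 1 (w m) (w 0)
    rw [one_smul, mul_one] at h1
    simp only [Nat.cast_add, Nat.cast_one, hper, h1, map_mul, hN]
    simp
  · intro δ i j
    have h1 := hw i j
    rw [hpt i, hpt j, pairDet_smul_smul] at h1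
    have h2 := congrArg (fun z => ((quadraticChar F z : ℤ) : ℂ)) h1
    simp only [map_mul, map_pow, hN, Int.cast_mul, Int.cast_pow, Int.cast_neg, Int.cast_one] at h2
    rw [paleySignature_apply hF, hs, ← h2, Equiv.ofBijective_apply, Equiv.ofBijective_apply]
    ring

lemma exists_pow_eq_neg_one {n : ℕ} (hn : 0 < n) : ∃ ζ : ℂ, ‖ζ‖ = 1 ∧ ζ ^ n = -1 := by
  obtain ⟨ζ, hζ⟩ := IsAlgClosed.exists_pow_nat_eq (-1 : ℂ) hn
  refine ⟨ζ, Complex.norm_eq_one_of_pow_eq_one (n := n * 2) ?_ (by omega), hζ⟩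
  rw [pow_mul, hζ]; norm_num

/-- Subtraction in `Fin n` may wrap around; periodicity makes this harmless, so such functions
define circulant blocks. -/
lemma Function.Periodic.apply_fin_sub {α : Type*} {n : ℕ} {f : ℤ → α}
    (hf : Function.Periodic f n) (i j : Fin n) : f ((i - j : Fin n) : ℕ) = f ((i : ℤ) - j) := by
  have h := Fin.intCast_val_sub_eq_sub_add_ite i j
  rw [h]
  split_ifs
  · simp
  · rw [hf]

/-- The even and odd elements of `Fin (2d)`. -/
lemma exists_even_odd_equiv (d : ℕ) {n : ℕ} (hn : n = 2 * d) :
    ∃ e : Fin d ⊕ Fin d ≃ Fin n, (∀ i, (e (.inl i) : ℕ) = 2 * i) ∧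
      ∀ i, (e (.inr i) : ℕ) = 2 * i + 1 := by
  let f : Fin d ⊕ Fin d → Fin n :=
    Sum.elim (fun i => ⟨2 * i, by omega⟩) (fun i => ⟨2 * i + 1, by omega⟩)
  have hf : Function.Injective f := by
    rintro (i | i) (j | j) h <;> simp only [f, Sum.elim_inl, Sum.elim_inr, Fin.mk.injEq] at h
    · exact congrArg _ (Fin.ext (by omega))
    · omega
    · omega
    · exact congrArg _ (Fin.ext (by omega))
  exact ⟨Equiv.ofBijective f ((Fintype.bijective_iff_injective_and_card f).2
    ⟨hf, by simp [hn, two_mul]⟩), fun _ => rfl, fun _ => rfl⟩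

lemma star_pow_mul_pow {ζ : ℂ} (hζ : ‖ζ‖ = 1) (i j : ℕ) :
    star (ζ ^ i) * ζ ^ j = ζ ^ (-((i : ℤ) - j)) := by
  have h0 : ζ ≠ 0 := norm_ne_zero_iff.1 (by rw [hζ]; exact one_ne_zero)
  rw [star_pow, RCLike.star_def, ← Complex.inv_eq_conj hζ, neg_sub, zpow_sub₀ h0, zpow_natCast,
    zpow_natCast, inv_pow, div_eq_mul_inv, mul_comm]

/-- The phases ζ^(-m) change sign under a shift by n, so their product with a sequence of the same
kind is periodic. -/
lemma zpow_neg_add_of_pow_eq_neg_one {ζ : ℂ} (hζ : ‖ζ‖ = 1) {n : ℕ} (hn : ζ ^ n = -1) (m : ℤ) :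
    ζ ^ (-(m + n)) = -ζ ^ (-m) := by
  have h0 : ζ ≠ 0 := norm_ne_zero_iff.1 (by rw [hζ]; exact one_ne_zero)
  rw [neg_add, zpow_add₀ h0, zpow_neg, zpow_neg _ (n : ℤ), zpow_natCast, hn]
  norm_num

-- With positions 2a and 2a+1 collected separately, the sign (-1)^j is constant on each block of
-- columns: + on the even and - on the odd ones. The diagonal blocks are thus X and -X, from the
-- even values of h. In a the sequences h(2a) and h(2a-1) change sign under a shift by d, and phases
-- ζ^a with ζ^d = -1 repair this.
set_option linter.unusedSimpArgs false in
theorem switchesToTwoCirculantETF_paley (hF : Odd (Fintype.card F)) (δ : ℤˣ) :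
    SwitchesToTwoCirculantETF ((Fintype.card F + 1) / 2) (paleySignature F δ) := by
  obtain ⟨e, s, h, hs, hh, hS⟩ := exists_singer_order hF rfl
  set d := (Fintype.card F + 1) / 2 with hd
  have hd2 : Fintype.card F + 1 = 2 * d := by
    have := Nat.odd_iff.1 hF
    omega
  have hd0 : 0 < d := by omega
  have hd2C : (2 * d : ℂ) = Fintype.card F + 1 := by exact_mod_cast hd2.symm
  have hh' : ∀ m, h (m + 2 * d) = -h m := fun m => by rw [← hh, hd2]; push_cast; rfl
  obtain ⟨ζ, hζ, hζd⟩ := exists_pow_eq_neg_one hd0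
  obtain ⟨σ, hσl, hσr⟩ := exists_even_odd_equiv d hd2
  have hsn : ∀ i, ‖s i‖ = 1 := fun i => norm_eq_one_of_mul_star (by rw [mul_comm, hs])
  have hper : ∀ k : ℤ, Function.Periodic
      (fun m : ℤ => paleyScalar F δ * (ζ ^ (-m) * h (2 * m + k))) (d : ℤ) := fun k m => by
    change _ * (ζ ^ (-(m + d)) * h (2 * (m + d) + k)) = _
    rw [zpow_neg_add_of_pow_eq_neg_one hζ hζd, show 2 * (m + d) + k = 2 * m + k + 2 * d by ring,
      hh', neg_mul_neg]
  have hperiod := fun k i j => (hper k).apply_fin_sub i j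
  refine switchesToTwoCirculantETF_of_circulant_blocks hd0 (paleySignature_diag hF δ)
    (norm_paleySignature hF δ) (paleySignature_conjTranspose hF δ)
    (by rw [paleySignature_mul_self hF, hd2C, add_sub_cancel_right]) (σ.trans e)
    (Sum.elim (fun i => ζ ^ (i : ℕ) * s (σ (.inl i))) fun i => ζ ^ (i : ℕ) * s (σ (.inr i))) ?_
    (fun t => paleyScalar F δ * (ζ ^ (-((t : ℕ) : ℤ)) * h (2 * (t : ℕ) + 0)))
    (fun t => -(paleyScalar F δ * (ζ ^ (-((t : ℕ) : ℤ)) * h (2 * (t : ℕ) + -1)))) ?_ ?_ ?_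
  · rintro (i | i) <;> simp [hζ, hsn]
  · intro i j
    rw [hperiod 0, ← star_pow_mul_pow hζ]
    have h1 := hS δ (σ (.inl i)) (σ (.inl j))
    simp only [hσl, pow_mul, neg_one_sq, one_pow, one_mul] at h1
    push_cast at h1
    simp only [Sum.elim_inl, Equiv.trans_apply, star_mul']
    rw [show 2 * ((i : ℤ) - j) + 0 = 2 * i - 2 * j by ring]
    linear_combination star (ζ ^ (i : ℕ)) * ζ ^ (j : ℕ) * h1
  · intro i j
    rw [hperiod (-1), ← star_pow_mul_pow hζ]
    have h1 := hS δ (σ (.inl i)) (σ (.inr j))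
    simp only [hσl, hσr, pow_succ, pow_mul, neg_one_sq, one_pow, one_mul] at h1
    push_cast at h1
    simp only [Sum.elim_inl, Sum.elim_inr, Equiv.trans_apply, star_mul']
    rw [show 2 * ((i : ℤ) - j) + -1 = 2 * i - (2 * j + 1) by ring]
    linear_combination star (ζ ^ (i : ℕ)) * ζ ^ (j : ℕ) * h1
  · intro i j
    rw [hperiod 0, ← star_pow_mul_pow hζ]
    have h1 := hS δ (σ (.inr i)) (σ (.inr j))
    simp only [hσr, pow_succ, pow_mul, neg_one_sq, one_pow, one_mul] at h1
    push_cast at h1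
    simp only [Sum.elim_inr, Equiv.trans_apply, star_mul']
    rw [show 2 * ((i : ℤ) - j) + 0 = (2 * i + 1) - (2 * j + 1) by ring]
    linear_combination star (ζ ^ (i : ℕ)) * ζ ^ (j : ℕ) * h1

/-- Exchange of the two copies of the odd elements of `Fin n`. -/
def swapOdd (n : ℕ) : Fin n ⊕ Fin n ≃ Fin n ⊕ Fin n where
  toFun := Sum.elim (fun i => if Even (i : ℕ) then .inl i else .inr i)
    fun i => if Even (i : ℕ) then .inr i else .inl i
  invFun := Sum.elim (fun i => if Even (i : ℕ) then .inl i else .inr i)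
    fun i => if Even (i : ℕ) then .inr i else .inl i
  left_inv := by rintro (i | i) <;> by_cases h : Even (i : ℕ) <;> simp [h]
  right_inv := by rintro (i | i) <;> by_cases h : Even (i : ℕ) <;> simp [h]

lemma doublingConst_half {n : ℕ} (hn : Even n) : doublingConst (n / 2) n = 0 := by
  obtain ⟨k, rfl⟩ := hn
  have : (k + k) / 2 = k := by omega
  rw [doublingConst, this]
  push_cast
  ring

-- Here c = 0 and β = εi. The first family takes even positions from the first copy of S and odd
-- positions from the second, the other family takes the rest, and the second copy gets the phase i.
-- The entry (-1)^j h(i-j) then acquires a factor depending only on the parity of i-j, so the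
-- alternating sign disappears.
set_option linter.unusedSimpArgs false in
theorem switchesToTwoCirculantETF_doubled_paley (hF : Odd (Fintype.card F)) (δ ε : ℤˣ) :
    SwitchesToTwoCirculantETF (Fintype.card F + 1)
      (doubleSignature ((Fintype.card F + 1) / 2) ε (paleySignature F δ)) := by
  obtain ⟨n, hn⟩ : ∃ n, n = Fintype.card F + 1 := ⟨_, rfl⟩
  obtain ⟨e, s, h, hs, hhn, hS⟩ := exists_singer_order hF hn
  have hcard : Fintype.card (Unit ⊕ F) = n := by simp [add_comm, hn]
  have heven : Even n := hn ▸ hF.add_one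
  rw [← hn]
  have hconst : doublingConst (n / 2) (Fintype.card (Unit ⊕ F)) = 0 := by
    rw [hcard, doublingConst_half heven]
  have hβ : doublingBeta (n / 2) (Fintype.card (Unit ⊕ F)) ε = ((ε : ℤ) : ℂ) * Complex.I := by
    rw [doublingBeta, hconst]
    simp
  have hc1 : doublingConst (n / 2) (Fintype.card (Unit ⊕ F)) ^ 2 ≤ 1 := by
    rw [hconst]; norm_num
  have hSS : paleySignature F δ * paleySignature F δ =
      ((Fintype.card (Unit ⊕ F) : ℂ) - 1) • (1 : Matrix (Unit ⊕ F) (Unit ⊕ F) ℂ) +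
      (doublingConst (n / 2) (Fintype.card (Unit ⊕ F)) : ℂ) • paleySignature F δ := by
    rw [hconst, paleySignature_mul_self hF, hcard, hn]
    simp
  have hDD := doubleSignature_mul_self ε hc1 hSS
  rw [hcard] at hDD
  obtain ⟨ζ, hζ, hζn⟩ := exists_pow_eq_neg_one (n := n) (by omega)
  have hsn : ∀ i, ‖s i‖ = 1 := fun i => norm_eq_one_of_mul_star (by rw [mul_comm, hs])
  have hper : ∀ a b : ℂ, Function.Periodic (fun m : ℤ =>
      paleyScalar F δ * (ζ ^ (-m) * ((if Even m then a else b) * h m))) (n : ℤ) := fun a b m => by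
    -- The parity of a difference is well defined modulo n because n = q+1 is even.
    have hpar : Even (m + n) ↔ Even m := by
      rw [Int.even_add, iff_true_right ((Int.even_coe_nat n).2 heven)]
    change _ * (ζ ^ (-(m + n)) * ((if Even (m + n) then a else b) * h (m + n))) = _
    simp only [zpow_neg_add_of_pow_eq_neg_one hζ hζn, hhn, hpar]
    ring
  have hperiod := fun a b i j => (hper a b).apply_fin_sub i j
  set φ : (Unit ⊕ F) ⊕ (Unit ⊕ F) → ℂ := Sum.elim (fun _ => 1) fun _ => Complex.I with hφ
  set τ := (swapOdd n).trans (Equiv.sumCongr e e) with hτ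
  have hl0 : ∀ i : Fin n, Even (i : ℕ) → τ (.inl i) = .inl (e i) := fun i hi => by
    simp [hτ, swapOdd, hi]
  have hl1 : ∀ i : Fin n, ¬Even (i : ℕ) → τ (.inl i) = .inr (e i) := fun i hi => by
    simp [hτ, swapOdd, hi]
  have hr0 : ∀ i : Fin n, Even (i : ℕ) → τ (.inr i) = .inr (e i) := fun i hi => by
    simp [hτ, swapOdd, hi]
  have hr1 : ∀ i : Fin n, ¬Even (i : ℕ) → τ (.inr i) = .inl (e i) := fun i hi => by
    simp [hτ, swapOdd, hi]
  have hφ1 : ∀ a, ‖φ a‖ = 1 := by rintro (a | a) <;> simp [hφ]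
  have hsub : ∀ i j : Fin n, Even ((i : ℤ) - j) ↔ (Even (i : ℕ) ↔ Even (j : ℕ)) := fun i j => by
    rw [Int.even_sub, Int.even_coe_nat, Int.even_coe_nat]
  have hII := Complex.I_mul_I
  have h00 : ∀ i j, doubleSignature (n / 2) ε (paleySignature F δ) (.inl (e i)) (.inl (e j)) =
      paleySignature F δ (e i) (e j) := fun _ _ => rfl
  have h11 : ∀ i j, doubleSignature (n / 2) ε (paleySignature F δ) (.inr (e i)) (.inr (e j)) =
      -paleySignature F δ (e i) (e j) := fun _ _ => rfl
  have h01 : ∀ i j, doubleSignature (n / 2) ε (paleySignature F δ) (.inl (e i)) (.inr (e j)) =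
      paleySignature F δ (e i) (e j) + ((ε : ℤ) : ℂ) * Complex.I * if i = j then 1 else 0 :=
    fun i j => by
      rw [doubleSignature, hβ]
      simp [Matrix.one_apply]
  have h10 : ∀ i j, doubleSignature (n / 2) ε (paleySignature F δ) (.inr (e i)) (.inl (e j)) =
      paleySignature F δ (e i) (e j) - ((ε : ℤ) : ℂ) * Complex.I * if i = j then 1 else 0 :=
    fun i j => by
      rw [doubleSignature, hβ]
      by_cases hij : i = j <;> simp [hij, sub_eq_add_neg]
  have hδ : ∀ i j : Fin n, star (ζ ^ (i : ℕ)) * star (s i) * (if i = j then 1 else 0) *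
      (ζ ^ (j : ℕ) * s j) = if i = j then 1 else 0 := fun i j => by
    split_ifs with hij
    · subst hij
      have h1 : ζ ^ (i : ℕ) * star (ζ ^ (i : ℕ)) = 1 :=
        mul_star_of_norm_eq_one (by rw [norm_pow, hζ, one_pow])
      linear_combination star (s i) * s i * h1 + hs i
    · ring
  have hval : ∀ i j : Fin n, ((i - j : Fin n) : ℕ) = 0 ↔ i = j := fun i j => by
    have : NeZero n := ⟨by omega⟩
    rw [Fin.val_eq_zero_iff, sub_eq_zero]
  refine switchesToTwoCirculantETF_of_circulant_blocks (d := n) (by omega)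
    (doubleSignature_diag ε (paleySignature_diag hF δ))
    (norm_doubleSignature ε hc1 (paleySignature_diag hF δ) (norm_paleySignature hF δ))
    (doubleSignature_conjTranspose ε (paleySignature_conjTranspose hF δ)) hDD τ
    (Sum.elim (fun i => ζ ^ (i : ℕ) * s i * φ (τ (.inl i)))
      fun i => ζ ^ (i : ℕ) * s i * φ (τ (.inr i))) ?_
    -- In the diagonal block, even differences carry 1 and odd ones -i; for instance odd-odd pairs
    -- give (-i)(i)(-1)(-1)^j = 1. In the other block the factors are i and -1, and the term ±εi on
    -- the diagonal meets the phase ±i, which produces -ε at difference 0.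
    (fun t => paleyScalar F δ * (ζ ^ (-((t : ℕ) : ℤ)) *
      ((if Even ((t : ℕ) : ℤ) then 1 else -Complex.I) * h (t : ℕ))))
    (fun t => paleyScalar F δ * (ζ ^ (-((t : ℕ) : ℤ)) *
      ((if Even ((t : ℕ) : ℤ) then Complex.I else -1) * h (t : ℕ))) -
      ((ε : ℤ) : ℂ) * if (t : ℕ) = 0 then 1 else 0) ?_ ?_ ?_
  · rintro (i | i) <;> simp [hζ, hsn, hφ1]
  · intro i j
    have h1 := hS δ i j
    simp only [hperiod, hval, ← star_pow_mul_pow hζ, hsub, Sum.elim_inl, Sum.elim_inr, star_mul']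
    by_cases hi : Even (i : ℕ) <;> by_cases hj : Even (j : ℕ)
    · rw [Even.neg_one_pow hj] at h1
      simp only [hl0 i hi, hl0 j hj, h00, hi, hj, hφ, Sum.elim_inl, Sum.elim_inr, star_one, RCLike.star_def,
        Complex.conj_I, if_true, if_false, iff_true, iff_false, not_true, not_false_iff]
      simp only [← RCLike.star_def]
      linear_combination star (ζ ^ (i : ℕ)) * ζ ^ (j : ℕ) * h1
    · have hij : i ≠ j := by rintro rfl; contradiction
      rw [Odd.neg_one_pow (Nat.not_even_iff_odd.1 hj)] at h1
      simp only [hl0 i hi, hl1 j hj, h01, if_neg hij, hi, hj, hφ, Sum.elim_inl, Sum.elim_inr, star_one, RCLike.star_def,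
        Complex.conj_I, if_true, if_false, iff_true, iff_false, not_true, not_false_iff]
      simp only [← RCLike.star_def]
      linear_combination star (ζ ^ (i : ℕ)) * ζ ^ (j : ℕ) * Complex.I * h1
    · have hij : i ≠ j := by rintro rfl; contradiction
      rw [Even.neg_one_pow hj] at h1
      simp only [hl1 i hi, hl0 j hj, h10, if_neg hij, hi, hj, hφ, Sum.elim_inl, Sum.elim_inr, star_one, RCLike.star_def,
        Complex.conj_I, if_true, if_false, iff_true, iff_false, not_true, not_false_iff]
      simp only [← RCLike.star_def]
      linear_combination -star (ζ ^ (i : ℕ)) * ζ ^ (j : ℕ) * Complex.I * h1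
    · rw [Odd.neg_one_pow (Nat.not_even_iff_odd.1 hj)] at h1
      simp only [hl1 i hi, hl1 j hj, h11, hi, hj, hφ, Sum.elim_inl, Sum.elim_inr, star_one, RCLike.star_def,
        Complex.conj_I, if_true, if_false, iff_true, iff_false, not_true, not_false_iff]
      simp only [← RCLike.star_def]
      linear_combination -star (ζ ^ (i : ℕ)) * ζ ^ (j : ℕ) * h1 +
        star (ζ ^ (i : ℕ)) * star (s i) * paleySignature F δ (e i) (e j) * (ζ ^ (j : ℕ) * s j) * hII
  · intro i j
    have h1 := hS δ i j
    simp only [hperiod, hval, ← star_pow_mul_pow hζ, hsub, Sum.elim_inl, Sum.elim_inr, star_mul']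
    by_cases hi : Even (i : ℕ) <;> by_cases hj : Even (j : ℕ)
    · rw [Even.neg_one_pow hj] at h1
      simp only [hl0 i hi, hr0 j hj, h01, hi, hj, hφ, Sum.elim_inl, Sum.elim_inr, star_one, RCLike.star_def,
        Complex.conj_I, if_true, if_false, iff_true, iff_false, not_true, not_false_iff]
      simp only [← RCLike.star_def]
      linear_combination star (ζ ^ (i : ℕ)) * ζ ^ (j : ℕ) * Complex.I * h1 +
        ((ε : ℤ) : ℂ) * Complex.I * Complex.I * hδ i j +
        ((ε : ℤ) : ℂ) * (if i = j then 1 else 0) * hII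
    · have hij : i ≠ j := by rintro rfl; contradiction
      rw [Odd.neg_one_pow (Nat.not_even_iff_odd.1 hj)] at h1
      simp only [hl0 i hi, hr1 j hj, h00, if_neg hij, hi, hj, hφ, Sum.elim_inl, Sum.elim_inr, star_one, RCLike.star_def,
        Complex.conj_I, if_true, if_false, iff_true, iff_false, not_true, not_false_iff]
      simp only [← RCLike.star_def]
      linear_combination star (ζ ^ (i : ℕ)) * ζ ^ (j : ℕ) * h1
    · have hij : i ≠ j := by rintro rfl; contradiction
      rw [Even.neg_one_pow hj] at h1
      simp only [hl1 i hi, hr0 j hj, h11, if_neg hij, hi, hj, hφ, Sum.elim_inl, Sum.elim_inr, star_one, RCLike.star_def,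
        Complex.conj_I, if_true, if_false, iff_true, iff_false, not_true, not_false_iff]
      simp only [← RCLike.star_def]
      linear_combination -star (ζ ^ (i : ℕ)) * ζ ^ (j : ℕ) * h1 +
        star (ζ ^ (i : ℕ)) * star (s i) * paleySignature F δ (e i) (e j) * (ζ ^ (j : ℕ) * s j) * hII
    · rw [Odd.neg_one_pow (Nat.not_even_iff_odd.1 hj)] at h1
      simp only [hl1 i hi, hr1 j hj, h10, hi, hj, hφ, Sum.elim_inl, Sum.elim_inr, star_one, RCLike.star_def,
        Complex.conj_I, if_true, if_false, iff_true, iff_false, not_true, not_false_iff]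
      simp only [← RCLike.star_def]
      linear_combination -star (ζ ^ (i : ℕ)) * ζ ^ (j : ℕ) * Complex.I * h1 +
        ((ε : ℤ) : ℂ) * Complex.I * Complex.I * hδ i j +
        ((ε : ℤ) : ℂ) * (if i = j then 1 else 0) * hII
  · intro i j
    have h1 := hS δ i j
    simp only [hperiod, hval, ← star_pow_mul_pow hζ, hsub, Sum.elim_inl, Sum.elim_inr, star_mul']
    by_cases hi : Even (i : ℕ) <;> by_cases hj : Even (j : ℕ)
    · rw [Even.neg_one_pow hj] at h1
      simp only [hr0 i hi, hr0 j hj, h11, hi, hj, hφ, Sum.elim_inl, Sum.elim_inr, star_one, RCLike.star_def,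
        Complex.conj_I, if_true, if_false, iff_true, iff_false, not_true, not_false_iff]
      simp only [← RCLike.star_def]
      linear_combination -star (ζ ^ (i : ℕ)) * ζ ^ (j : ℕ) * h1 +
        star (ζ ^ (i : ℕ)) * star (s i) * paleySignature F δ (e i) (e j) * (ζ ^ (j : ℕ) * s j) * hII
    · have hij : i ≠ j := by rintro rfl; contradiction
      rw [Odd.neg_one_pow (Nat.not_even_iff_odd.1 hj)] at h1
      simp only [hr0 i hi, hr1 j hj, h10, if_neg hij, hi, hj, hφ, Sum.elim_inl, Sum.elim_inr, star_one, RCLike.star_def,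
        Complex.conj_I, if_true, if_false, iff_true, iff_false, not_true, not_false_iff]
      simp only [← RCLike.star_def]
      linear_combination -star (ζ ^ (i : ℕ)) * ζ ^ (j : ℕ) * Complex.I * h1
    · have hij : i ≠ j := by rintro rfl; contradiction
      rw [Even.neg_one_pow hj] at h1
      simp only [hr1 i hi, hr0 j hj, h01, if_neg hij, hi, hj, hφ, Sum.elim_inl, Sum.elim_inr, star_one, RCLike.star_def,
        Complex.conj_I, if_true, if_false, iff_true, iff_false, not_true, not_false_iff]
      simp only [← RCLike.star_def]
      linear_combination star (ζ ^ (i : ℕ)) * ζ ^ (j : ℕ) * Complex.I * h1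
    · rw [Odd.neg_one_pow (Nat.not_even_iff_odd.1 hj)] at h1
      simp only [hr1 i hi, hr1 j hj, h00, hi, hj, hφ, Sum.elim_inl, Sum.elim_inr, star_one, RCLike.star_def,
        Complex.conj_I, if_true, if_false, iff_true, iff_false, not_true, not_false_iff]
      simp only [← RCLike.star_def]
      linear_combination star (ζ ^ (i : ℕ)) * ζ ^ (j : ℕ) * h1

end Switching

theorem mainTheorem3 (q : ℕ) (hq : Odd q) (F : Type*) [Field F] [Fintype F] [DecidableEq F]
    (hF : Fintype.card F = q) :
    -- the Paley ETFs `G_q + 1`, for both signs of the Paley conference matrix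
    (∀ δ : ℤˣ, SwitchesToTwoCirculantETF ((q + 1) / 2) (paleySignature F δ)) ∧
    -- the doubled Paley graph `2 · G_q`, `q ≡ 1 mod 4` prime
    (q.Prime → q % 4 = 1 → ∀ ε : ℤˣ,
      SwitchesToTwoCirculantETF q (doubleGraphSignature ε (paleyAdjMatrix F))) ∧
    -- the doubled Renes--Strohmer ETF (of size `(q+1)/2 × q`) `2 · G_q`, `q ≡ 3 mod 4` prime,
    -- and the double of its Naimark complement (of size `(q-1)/2 × q`)
    (q.Prime → q % 4 = 3 → ∀ ε : ℤˣ,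
      SwitchesToTwoCirculantETF q
        (doubleSignature ((q + 1) / 2) ε (renesStrohmerSignature F)) ∧
      SwitchesToTwoCirculantETF q
        (doubleSignature ((q - 1) / 2) ε (-renesStrohmerSignature F))) ∧
    -- the doubled Paley ETFs `2 · (G_q + 1)`
    (∀ δ ε : ℤˣ, SwitchesToTwoCirculantETF (q + 1)
      (doubleSignature ((q + 1) / 2) ε (paleySignature F δ))) := by
  subst hF
  refine ⟨fun δ => switchesToTwoCirculantETF_paley hq δ,
    fun hp h4 ε => switchesToTwoCirculantETF_doubled_paley_graph hp h4 ε,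
    fun hp h4 ε => ⟨?_, ?_⟩, fun δ ε => switchesToTwoCirculantETF_doubled_paley hq δ ε⟩
  · have h := switchesToTwoCirculantETF_doubled_renesStrohmer hp h4 ε 1
      (d := (Fintype.card F + 1) / 2) (by rw [Units.val_one]; omega)
    rwa [Units.val_one, Int.cast_one, one_smul] at h
  · have h := switchesToTwoCirculantETF_doubled_renesStrohmer hp h4 ε (-1)
      (d := (Fintype.card F - 1) / 2) (by rw [Units.val_neg, Units.val_one]; omega)
    rwa [Units.val_neg, Units.val_one, Int.cast_neg, Int.cast_one, neg_one_smul] at h
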